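/- Let $\Sigma$ be a nonempty (finite or infinite) set of proposition letters. Finite words are nonempty finite sequences $\sigma=\sigma_0\cdots\sigma_{n-1}\in(2^\Sigma)^+$. Let $\mathsf{coSafetyLTL}(-\mathsf{wX})$ be the set of LTL formulas generated by $$\phi ::= p \mid \neg p \mid \phi\lor\phi \mid \phi\land\phi \mid \mathsf{X}\phi \mid \phi\,\mathsf{U}\,\phi \qquad (p\in\Sigma),$$ that is, formulas in negated normal form whose only temporal operators are tomorrow and until (no weak tomorrow). For $0\le i<|\sigma|$, Boolean connectives are interpreted as usual; $\sigma,i\models p$ iff $p\in\sigma_i$; $\sigma,i\models\mathsf{X}\phi$ iff $i+1<|\sigma|$ and $\sigma,i+1\models\phi$; $\sigma,i\models\phi_1\mathsf{U}\phi_2$ iff there is $i\le j<|\sigma|$ with $\sigma,j\models\phi_2$ and $\sigma,k\models\phi_1$ for all $i\le k<j$. The language of finite words of $\phi$ is $\mathcal{L}^{<\omega}(\phi)=\{\sigma\in(2^\Sigma)^+ : \sigma,0\models\phi\}$. Let $\mathsf{coSafetyFO}$ be the set of first-order formulas over the signature $\langle <,\{P\}_{p\in\Sigma}\rangle$ with equality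 generated by $$\phi ::= x<y \mid x=y \mid x\neq y \mid P(x) \mid \neg P(x) \mid \phi\lor\phi \mid \phi\land\phi \mid \exists y\,(x<y\land\phi) \mid \forall y\,(x<y<z\to\phi),$$ where $x,y,z$ are first-order variables and, in the two quantifier clauses, $y$ is different from $x$ and $z$. A finite word $\sigma$ is viewed as the structure with domain $\{0,\dots,|\sigma|-1\}$, the usual order, and $P$ holding at position $i$ iff $p\in\sigma_i$. For a formula $\phi(x)$ with exactly one free variable, $\mathcal{L}^{<\omega}(\phi)$ is the set of $\sigma\in(2^\Sigma)^+$ that satisfy $\phi(x)$ when $x$ is interpreted as position $0$. Then a set of finite words is of the form $\mathcal{L}^{<\omega}(\phi)$ for some $\phi(x)\in\mathsf{coSafetyFO}$ with exactly one free variable if and only if it is of the form $\mathcal{L}^{<\omega}(\psi)$ for some $\psi\in\mathsf{coSafetyLTL}(-\mathsf{wX})$. -/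

import Mathlib

universe u v

/-- Formulas of (pure future) linear temporal logic over the proposition letters `AP`. -/
inductive LTL (AP : Type u) : Type u
  | atom (p : AP) : LTL AP
  | not (φ : LTL AP) : LTL AP
  | or (φ ψ : LTL AP) : LTL AP
  | and (φ ψ : LTL AP) : LTL AP
  | next (φ : LTL AP) : LTL AP
  | weakNext (φ : LTL AP) : LTL AP
  | untl (φ ψ : LTL AP) : LTL AP
  | release (φ ψ : LTL AP) : LTL AP

namespace LTL

variable {AP : Type u}

/-- Satisfaction of a formula at a position of a finite state sequence
(a finite word over the alphabet of all subsets of `AP`). -/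
def Sat (σ : List (Set AP)) : LTL AP → Fin σ.length → Prop
  | atom p, i => p ∈ σ.get i
  | not φ, i => ¬ Sat σ φ i
  | or φ ψ, i => Sat σ φ i ∨ Sat σ ψ i
  | and φ ψ, i => Sat σ φ i ∧ Sat σ ψ i
  | next φ, i => ∃ h : i.val + 1 < σ.length, Sat σ φ ⟨i.val + 1, h⟩
  | weakNext φ, i => ∀ h : i.val + 1 < σ.length, Sat σ φ ⟨i.val + 1, h⟩
  | untl φ ψ, i => ∃ j, i ≤ j ∧ Sat σ ψ j ∧ ∀ k, i ≤ k → k < j → Sat σ φ k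
  | release φ ψ, i =>
      (∀ j, i ≤ j → Sat σ ψ j) ∨
        ∃ k, i ≤ k ∧ Sat σ φ k ∧ ∀ j, i ≤ j → j ≤ k → Sat σ ψ j

/-- The language of finite (nonempty) words of a formula. -/
def langFin (φ : LTL AP) : Set (List (Set AP)) :=
  {σ | ∃ h : 0 < σ.length, Sat σ φ ⟨0, h⟩}

/-- The fragment coSafetyLTL: formulas in negated normal form (negation applied only to
proposition letters) whose only temporal operators are tomorrow, weak tomorrow and until. -/
inductive IsCoSafety : LTL AP → Prop
  | atom (p : AP) : IsCoSafety (atom p)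
  | notAtom (p : AP) : IsCoSafety (not (atom p))
  | or {φ ψ : LTL AP} : IsCoSafety φ → IsCoSafety ψ → IsCoSafety (or φ ψ)
  | and {φ ψ : LTL AP} : IsCoSafety φ → IsCoSafety ψ → IsCoSafety (and φ ψ)
  | next {φ : LTL AP} : IsCoSafety φ → IsCoSafety (next φ)
  | weakNext {φ : LTL AP} : IsCoSafety φ → IsCoSafety (weakNext φ)
  | untl {φ ψ : LTL AP} : IsCoSafety φ → IsCoSafety ψ → IsCoSafety (untl φ ψ)

/-- The weak tomorrow operator does not occur in the formula. -/
def WeakNextFree : LTL AP → Prop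
  | atom _ => True
  | not φ => WeakNextFree φ
  | or φ ψ => WeakNextFree φ ∧ WeakNextFree ψ
  | and φ ψ => WeakNextFree φ ∧ WeakNextFree ψ
  | next φ => WeakNextFree φ
  | weakNext _ => False
  | untl φ ψ => WeakNextFree φ ∧ WeakNextFree ψ
  | release φ ψ => WeakNextFree φ ∧ WeakNextFree ψ

end LTL

/-- The logic coSafetyLTL without the weak tomorrow operator, as a set of LTL formulas. -/
def coSafetyLTLNoWeak (AP : Type u) : Set (LTL AP) :=
  {φ | φ.IsCoSafety ∧ φ.WeakNextFree}

/-- The languages of finite words definable in coSafetyLTL without weak tomorrow. -/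
def semFinCoSafetyLTLNoWeak (AP : Type u) : Set (Set (List (Set AP))) :=
  {L | ∃ φ ∈ coSafetyLTLNoWeak AP, L = φ.langFin}

/-- The relation symbols of the first-order theory of linear orders:
a binary symbol `<` and a unary symbol for every proposition letter. -/
inductive FOTLORel (AP : Type u) : ℕ → Type u
  | lt : FOTLORel AP 2
  | pred (p : AP) : FOTLORel AP 1

/-- The signature `⟨<, {P}_{p ∈ AP}⟩` (equality is built into first-order formulas). -/
def FOTLO (AP : Type u) : FirstOrder.Language.{0, u} where
  Functions := fun _ => Empty
  Relations := FOTLORel AP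

/-- The domain `{0, …, |σ| - 1}` of the first-order structure of a finite word `σ`. -/
abbrev WordDomain {AP : Type u} (σ : List (Set AP)) : Type := Fin σ.length

/-- The first-order structure of a finite word `σ`: `<` is the usual order of positions, and
the predicate of `p` holds at the positions whose letter contains `p`. -/
instance wordStructure {AP : Type u} (σ : List (Set AP)) :
    (FOTLO AP).Structure (WordDomain σ) where
  funMap := fun f _ => Empty.elim f
  RelMap := fun R =>
    match R with
    | FOTLORel.lt => fun xs => xs 0 < xs 1
    | FOTLORel.pred p => fun xs => p ∈ σ.get (xs 0)

namespace FOTLO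

variable {AP : Type u} {α : Type v} {n : ℕ}

/-- The symbol `<` of the signature. -/
def ltSym : (FOTLO AP).Relations 2 := FOTLORel.lt

/-- The unary predicate symbol of the proposition letter `p`. -/
def predSym (p : AP) : (FOTLO AP).Relations 1 := FOTLORel.pred p

/-- The atomic formula `x < y`. The variables of a bounded formula are the free variables in
`α` and the `n` variables in `Fin n` bound further outside. -/
def ltF (x y : α ⊕ Fin n) : (FOTLO AP).BoundedFormula α n :=
  ltSym.boundedFormula₂ (FirstOrder.Language.Term.var x) (FirstOrder.Language.Term.var y)

/-- The atomic formula `x = y`. -/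
def eqF (x y : α ⊕ Fin n) : (FOTLO AP).BoundedFormula α n :=
  FirstOrder.Language.Term.bdEqual (L := FOTLO AP) (FirstOrder.Language.Term.var x) (FirstOrder.Language.Term.var y)

/-- The atomic formula `P(x)`, for the unary predicate of the proposition letter `p`. -/
def predF (p : AP) (x : α ⊕ Fin n) : (FOTLO AP).BoundedFormula α n :=
  (predSym p).boundedFormula₁ (FirstOrder.Language.Term.var x)

/-- A variable, seen under one more quantifier. -/
def up (x : α ⊕ Fin n) : α ⊕ Fin (n + 1) := Sum.map id Fin.castSucc x

/-- The variable bound by the innermost quantifier. -/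
def bvar : α ⊕ Fin (n + 1) := Sum.inr (Fin.last n)

/-- The fragment coSafetyFO:
`φ ::= x < y | x = y | x ≠ y | P(x) | ¬ P(x) | φ ∨ φ | φ ∧ φ
  | ∃ y (x < y ∧ φ) | ∀ y (x < y < z → φ)`. -/
inductive IsCoSafety : {n : ℕ} → (FOTLO AP).BoundedFormula α n → Prop
  | lt {n : ℕ} (x y : α ⊕ Fin n) : IsCoSafety (ltF x y)
  | eq {n : ℕ} (x y : α ⊕ Fin n) : IsCoSafety (eqF x y)
  | ne {n : ℕ} (x y : α ⊕ Fin n) : IsCoSafety (eqF x y).not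
  | pred {n : ℕ} (p : AP) (x : α ⊕ Fin n) : IsCoSafety (predF p x)
  | notPred {n : ℕ} (p : AP) (x : α ⊕ Fin n) : IsCoSafety (predF p x).not
  | or {n : ℕ} {φ ψ : (FOTLO AP).BoundedFormula α n} :
      IsCoSafety φ → IsCoSafety ψ → IsCoSafety (φ ⊔ ψ)
  | and {n : ℕ} {φ ψ : (FOTLO AP).BoundedFormula α n} :
      IsCoSafety φ → IsCoSafety ψ → IsCoSafety (φ ⊓ ψ)
  | ex {n : ℕ} (x : α ⊕ Fin n) {φ : (FOTLO AP).BoundedFormula α (n + 1)} :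
      IsCoSafety φ → IsCoSafety (ltF (up x) bvar ⊓ φ).ex
  | all {n : ℕ} (x z : α ⊕ Fin n) {φ : (FOTLO AP).BoundedFormula α (n + 1)} :
      IsCoSafety φ → IsCoSafety ((ltF (up x) bvar ⊓ ltF bvar (up z)).imp φ).all

/-- The language of finite (nonempty) words of a formula with a single free variable, which
is interpreted as position `0`. -/
def langFin (φ : (FOTLO AP).Formula (Fin 1)) : Set (List (Set AP)) :=
  {σ | ∃ h : 0 < σ.length, φ.Realize (fun _ => (⟨0, h⟩ : WordDomain σ))}

end FOTLO

/-- The logic coSafetyFO with one free variable, as a set of first-order formulas. In such a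
formula the free variable always occurs, as guards and atoms refer to enclosing variables. -/
def coSafetyFO (AP : Type u) : Set ((FOTLO AP).Formula (Fin 1)) :=
  {φ | FOTLO.IsCoSafety φ}

/-- The languages of finite words definable in coSafetyFO. -/
def semFinCoSafetyFO (AP : Type u) : Set (Set (List (Set AP))) :=
  {L | ∃ φ ∈ coSafetyFO AP, L = FOTLO.langFin φ}

/-!
The easy half is the standard translation of temporal into first-order formulas. For the other
half, a coSafetyFO formula of quantifier depth `k` is analysed by an Ehrenfeucht–Fraïssé game on
words with marked positions. All marks lie at or after the initial position, universal quantifiers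
range between two marks, and only existential ones go beyond the last mark. Hence truth is
preserved when the segments between marks have the same rank-`k` first-order type (`wordType`) and
the suffix after each mark is compared in one direction only (`TailLE`); see
`FOTLO.IsCoSafety.exists_rank`. So the language of the formula is a finite union of languages
"a letter of a given colour, then a word of an up-set of `TailLE`", and such an up-set unfolds into
finite intersections of languages "a word of type `τ`, then a letter of colour `c`, then a word of
an up-set of smaller rank" (`upSet_finite_and_mem`).

What remains is that prefixing all words of a type `τ` does not lead out of coSafetyLTL, even
though the end of the prefix is not marked in the word. This is the substance of Kamp's theorem,
and it is proved by the local divisor technique of Diekert and Gastin. The types of rank `k` form a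
finite aperiodic monoid (`typeCon_aperiodic`). In the abstract setting of a deterministic transition
system labelled in such a monoid `M`, and a class of sets of states closed under union,
intersection, labelled tomorrow and until, the states from which a set of the class is reached along
a path with product `m` again form a set of the class (`reachSet_mem_of_card_le`). For a label
`c ≠ 1`, a path is cut at its `c`-steps; the blocks between them use fewer labels, and the sequence
of blocks is a path of a new transition system on the same states, labelled in the local divisor of
`M` at `c`, which is smaller than `M`. Tomorrow and until of the new system are definable by those
of the old one, because the end of a block is recognized by its label `c`
(`untilOn_blockStep_iff`).
-/

/-! ### Temporal classes over labelled transition systems -/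

/-- `UntilOn R D E w`: some `R`-path from `w` reaches a state of `E`, and all states before it lie
in `D`. -/
inductive UntilOn {W : Type v} {M : Type u} (R : W → M → W → Prop) (D E : Set W) : W → Prop
  | base {w : W} : w ∈ E → UntilOn R D E w
  | step {w w' : W} {a : M} : w ∈ D → R w a w' → UntilOn R D E w' → UntilOn R D E w

/-- `PathOf R w m w'`: there is an `R`-path from `w` to `w'` whose labels multiply up to `m`. -/
inductive PathOf {W : Type v} {M : Type u} [Monoid M] (R : W → M → W → Prop) : W → M → W → Prop
  | refl (w : W) : PathOf R w 1 w
  | step {w w' w'' : W} {a m : M} : R w a w' → PathOf R w' m w'' → PathOf R w (a * m) w''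

/-- Every state has at most one successor, reached under at most one label. -/
def DetStep {W : Type v} {M : Type u} (R : W → M → W → Prop) : Prop :=
  ∀ ⦃w a b w₁ w₂⦄, R w a w₁ → R w b w₂ → a = b ∧ w₁ = w₂

/-- The states that have an `a`-labelled successor in `D`. -/
def nextSet {W : Type v} {M : Type u} (R : W → M → W → Prop) (a : M) (D : Set W) : Set W :=
  {w | ∃ w', R w a w' ∧ w' ∈ D}

/-- A class of sets of states with the closure properties of a negation-free temporal logic
with labelled tomorrow and until. -/
structure TemporalClass {W : Type v} {M : Type u} (R : W → M → W → Prop)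
    (𝒟 : Set (Set W)) : Prop where
  univ_mem : Set.univ ∈ 𝒟
  empty_mem : ∅ ∈ 𝒟
  union_mem : ∀ {D E : Set W}, D ∈ 𝒟 → E ∈ 𝒟 → D ∪ E ∈ 𝒟
  inter_mem : ∀ {D E : Set W}, D ∈ 𝒟 → E ∈ 𝒟 → D ∩ E ∈ 𝒟
  next_mem : ∀ (a : M) {D : Set W}, D ∈ 𝒟 → nextSet R a D ∈ 𝒟
  until_mem : ∀ {D E : Set W}, D ∈ 𝒟 → E ∈ 𝒟 → {w | UntilOn R D E w} ∈ 𝒟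

namespace TemporalClass

variable {W : Type v} {M : Type u} {R : W → M → W → Prop} {𝒟 : Set (Set W)}

theorem sUnion_mem (h𝒟 : TemporalClass R 𝒟) {S : Set (Set W)} (hS : S.Finite) (h : S ⊆ 𝒟) :
    ⋃₀ S ∈ 𝒟 := by
  induction S, hS using Set.Finite.induction_on with
  | empty => simpa using h𝒟.empty_mem
  | insert _ _ ih =>
    rw [Set.sUnion_insert]
    exact h𝒟.union_mem (h (Set.mem_insert _ _)) (ih fun x hx => h (Set.mem_insert_of_mem _ hx))

theorem sInter_mem (h𝒟 : TemporalClass R 𝒟) {S : Set (Set W)} (hS : S.Finite) (h : S ⊆ 𝒟) :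
    ⋂₀ S ∈ 𝒟 := by
  induction S, hS using Set.Finite.induction_on with
  | empty => simpa using h𝒟.univ_mem
  | insert _ _ ih =>
    rw [Set.sInter_insert]
    exact h𝒟.inter_mem (h (Set.mem_insert _ _)) (ih fun x hx => h (Set.mem_insert_of_mem _ hx))

theorem iUnion_mem (h𝒟 : TemporalClass R 𝒟) {ι : Type*} [Finite ι] {f : ι → Set W}
    (h : ∀ i, f i ∈ 𝒟) : ⋃ i, f i ∈ 𝒟 :=
  h𝒟.sUnion_mem (Set.finite_range f) (by rintro _ ⟨i, rfl⟩; exact h i)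

/-- A temporal class remains one when the steps are restricted to a set of labels: in an until, the
states before the last one are required to have a successor under an allowed label. -/
theorem restrict [Finite M] (h𝒟 : TemporalClass R 𝒟) (hR : DetStep R) (B : Set M) :
    TemporalClass (fun w a w' => R w a w' ∧ a ∈ B) 𝒟 where
  univ_mem := h𝒟.univ_mem
  empty_mem := h𝒟.empty_mem
  union_mem := h𝒟.union_mem
  inter_mem := h𝒟.inter_mem
  next_mem := by
    intro a D hD
    by_cases ha : a ∈ B
    · convert h𝒟.next_mem a hD using 1
      ext w; simp [nextSet, ha]
    · convert h𝒟.empty_mem using 1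
      ext w; simp [nextSet, ha]
  until_mem := by
    intro D E hD hE
    have hB : (⋃ b : B, nextSet R b.1 Set.univ) ∈ 𝒟 :=
      h𝒟.iUnion_mem fun b => h𝒟.next_mem _ h𝒟.univ_mem
    convert h𝒟.until_mem (h𝒟.inter_mem hD hB) hE using 1
    ext w
    constructor
    · intro h
      induction h with
      | base h => exact .base h
      | step hw hR' _ ih =>
        exact UntilOn.step ⟨hw, Set.mem_iUnion.2 ⟨⟨_, hR'.2⟩, _, hR'.1, trivial⟩⟩ hR'.1 ih
    · intro h
      induction h with
      | base h => exact .base h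
      | step hw hR' _ ih =>
        obtain ⟨hw, hw2⟩ := hw
        obtain ⟨⟨b, hb⟩, w2, h2, -⟩ := Set.mem_iUnion.1 hw2
        obtain ⟨rfl, rfl⟩ := hR h2 hR'
        exact UntilOn.step hw ⟨hR', hb⟩ ih

end TemporalClass

theorem PathOf.trans {W : Type v} {M : Type u} [Monoid M] {R : W → M → W → Prop} {w w' w'' : W}
    {m m' : M} (h : PathOf R w m w') (h' : PathOf R w' m' w'') : PathOf R w (m * m') w'' := by
  induction h with
  | refl => simpa using h'
  | step hR _ ih => rw [mul_assoc]; exact .step hR (ih h')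

theorem PathOf.mono {W : Type v} {M : Type u} [Monoid M] {R S : W → M → W → Prop} {w w' : W}
    {m : M} (hRS : ∀ w a w', R w a w' → S w a w') (h : PathOf R w m w') : PathOf S w m w' := by
  induction h with
  | refl => exact .refl _
  | step hR _ ih => exact .step (hRS _ _ _ hR) ih

/-! ### Local divisors -/

/-- The local divisor of a monoid `M` at `c`: the set `cM ∩ Mc` with the product
`(x * c) ∘ (c * y) = x * c * y` and the identity `c`. -/
def LocalDivisor {M : Type u} [Monoid M] (c : M) : Type u :=
  {x : M // (∃ y, x = c * y) ∧ ∃ z, x = z * c}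

namespace LocalDivisor

variable {M : Type u} [Monoid M] {c : M}

instance [Finite M] : Finite (LocalDivisor c) := inferInstanceAs (Finite {_x : M // _})

noncomputable instance : Mul (LocalDivisor c) where
  mul x y := ⟨x.1 * y.2.1.choose, by
    obtain ⟨x, ⟨x₁, hx₁⟩, ⟨x₂, hx₂⟩⟩ := x
    have hy := y.2.1.choose_spec
    obtain ⟨y₂, hy₂⟩ := y.2.2
    refine ⟨⟨x₁ * y.2.1.choose, by simp only [hx₁, mul_assoc]⟩, ⟨x₂ * y₂, ?_⟩⟩
    change x * _ = _
    rw [hx₂, mul_assoc, ← hy, hy₂, mul_assoc]⟩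

theorem val_mul (x : LocalDivisor c) {y : LocalDivisor c} {w : M} (hy : y.1 = c * w) :
    (x * y).1 = x.1 * w := by
  obtain ⟨z, hz⟩ := x.2.2
  change x.1 * y.2.1.choose = _
  rw [hz, mul_assoc, ← y.2.1.choose_spec, hy, mul_assoc]

instance : One (LocalDivisor c) where
  one := ⟨c, ⟨1, by simp⟩, ⟨1, by simp⟩⟩

theorem val_one : (1 : LocalDivisor c).1 = c := rfl

noncomputable instance : Monoid (LocalDivisor c) where
  mul_assoc x y z := by
    obtain ⟨v, hv⟩ := y.2.1
    obtain ⟨w, hw⟩ := z.2.1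
    apply Subtype.ext
    have h : (y * z).1 = c * (v * w) := by rw [val_mul y hw, hv, mul_assoc]
    rw [val_mul _ hw, val_mul _ hv, val_mul _ h, mul_assoc]
  one_mul x := by
    obtain ⟨v, hv⟩ := x.2.1
    apply Subtype.ext
    rw [val_mul _ hv, val_one, hv]
  mul_one x := by
    apply Subtype.ext
    rw [val_mul (w := 1) _ (by simp [val_one]), mul_one]

theorem aperiodic (hM : ∀ y : M, ∃ k, y ^ k = y ^ (k + 1)) (x : LocalDivisor c) :
    ∃ k, x ^ k = x ^ (k + 1) := by
  obtain ⟨z, hz⟩ := x.2.1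
  have key : ∀ k, (x ^ k).1 = c * z ^ k := by
    intro k
    induction k with
    | zero => simp [val_one]
    | succ k ih => rw [pow_succ, val_mul _ hz, ih, pow_succ, mul_assoc]
  obtain ⟨k, hk⟩ := hM z
  exact ⟨k, Subtype.ext (by rw [key, key, hk])⟩

/-- In an aperiodic monoid only the identity is invertible, so local divisors are smaller. -/
theorem card_lt [Finite M] (hM : ∀ x : M, ∃ k, x ^ k = x ^ (k + 1)) (hc : c ≠ 1) :
    Nat.card (LocalDivisor c) < Nat.card M := by
  refine Finite.card_subtype_lt (x := (1 : M)) ?_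
  rintro ⟨⟨y, hy⟩, -⟩
  obtain ⟨k, hk⟩ := hM c
  have hpow : ∀ k, c ^ k * y ^ k = 1 := by
    intro k
    induction k with
    | zero => simp
    | succ k ih => rw [pow_succ, pow_succ', mul_assoc, ← mul_assoc c, ← hy, one_mul, ih]
  apply hc
  have h := hpow k
  rw [hk, pow_succ', mul_assoc, hpow k, mul_one] at h
  exact h

end LocalDivisor

/-! ### Reachability along paths with a prescribed product -/

section Blocks

variable {W : Type v} {M : Type u} [Monoid M]

/-- The steps of `R` whose label is not `c`. -/
def avoidStep (R : W → M → W → Prop) (c : M) : W → M → W → Prop :=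
  fun w a w' => R w a w' ∧ a ∈ ({c}ᶜ : Set M)

/-- A step that passes a whole block of `R`-steps, up to and including the first one labelled `c`.
A block `t, c` carries the label `c * t * c` of the local divisor at `c`. -/
def blockStep (R : W → M → W → Prop) (c : M) : W → LocalDivisor c → W → Prop :=
  fun w x w' => ∃ t w₁, PathOf (avoidStep R c) w t w₁ ∧ R w₁ c w' ∧ x.1 = c * t * c

variable {R : W → M → W → Prop} {c : M}

theorem avoidStep_path_det (hR : DetStep R) {w w₁ w₂ w₃ w₄ : W} {t s : M}
    (h₁ : PathOf (avoidStep R c) w t w₁) (h₁' : R w₁ c w₃)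
    (h₂ : PathOf (avoidStep R c) w s w₂) (h₂' : R w₂ c w₄) : t = s ∧ w₃ = w₄ := by
  induction h₁ generalizing s with
  | refl w =>
    cases h₂ with
    | refl => exact ⟨rfl, (hR h₁' h₂').2⟩
    | step h _ => exact absurd (hR h₁' h.1).1.symm h.2
  | step h _ ih =>
    cases h₂ with
    | refl => exact absurd (hR h.1 h₂').1 h.2
    | step h' hp =>
      obtain ⟨rfl, rfl⟩ := hR h.1 h'.1
      obtain ⟨rfl, rfl⟩ := ih h₁' hp
      exact ⟨rfl, rfl⟩

theorem blockStep_det (hR : DetStep R) : DetStep (blockStep R c) := by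
  rintro w x y w₁ w₂ ⟨t, v, hp, hv, hx⟩ ⟨s, v', hp', hv', hy⟩
  obtain ⟨rfl, rfl⟩ := avoidStep_path_det hR hp hv hp' hv'
  exact ⟨Subtype.ext (hx.trans hy.symm), rfl⟩

theorem path_of_blockStep_path {w w' : W} {x : LocalDivisor c}
    (h : PathOf (blockStep R c) w x w') : ∃ p, PathOf R w p w' ∧ x.1 = c * p := by
  induction h with
  | refl => exact ⟨1, .refl _, by simp [LocalDivisor.val_one]⟩
  | step hb _ ih =>
    obtain ⟨t, w₁, ht, hc, hx⟩ := hb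
    obtain ⟨p, hp, hxp⟩ := ih
    refine ⟨t * (c * p), (ht.mono fun _ _ _ h => h.1).trans (.step hc hp), ?_⟩
    rw [LocalDivisor.val_mul _ hxp, hx]
    simp only [mul_assoc]

/-- A path either avoids `c`, or splits at its first and its last `c`-step, with complete blocks
between them. -/
theorem path_iff_blocks {w w' : W} {m : M} :
    PathOf R w m w' ↔ PathOf (avoidStep R c) w m w' ∨
      ∃ (t : M) (x : LocalDivisor c) (s : M) (w₁ w₂ w₃ : W), PathOf (avoidStep R c) w t w₁ ∧
        R w₁ c w₂ ∧ PathOf (blockStep R c) w₂ x w₃ ∧ PathOf (avoidStep R c) w₃ s w' ∧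
        m = t * x.1 * s := by
  constructor
  · intro h
    induction h with
    | refl => exact .inl (.refl _)
    | @step w w' w'' a m hR _ ih =>
      by_cases hac : a = c
      · subst hac
        right
        rcases ih with ih | ⟨t, x, s, w₁, w₂, w₃, h1, h2, h3, h4, rfl⟩
        · exact ⟨1, 1, m, w, w', w', .refl _, hR, .refl _, ih, by simp [LocalDivisor.val_one]⟩
        · obtain ⟨y, hy⟩ := x.2.1
          let b : LocalDivisor a := ⟨a * t * a, ⟨t * a, mul_assoc ..⟩, ⟨a * t, rfl⟩⟩
          refine ⟨1, b * x, s, w, w', w₃, .refl _, hR, .step ⟨t, w₁, h1, h2, rfl⟩ h3, h4, ?_⟩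
          rw [LocalDivisor.val_mul _ hy, hy]
          simp only [b, mul_assoc, one_mul]
      · rcases ih with ih | ⟨t, x, s, w₁, w₂, w₃, h1, h2, h3, h4, rfl⟩
        · exact .inl (.step ⟨hR, hac⟩ ih)
        · exact .inr ⟨a * t, x, s, w₁, w₂, w₃, .step ⟨hR, hac⟩ h1, h2, h3, h4, by
            simp only [mul_assoc]⟩
  · rintro (h | ⟨t, x, s, w₁, w₂, w₃, h1, h2, h3, h4, rfl⟩)
    · exact h.mono fun _ _ _ h => h.1
    · obtain ⟨p, hp, hx⟩ := path_of_blockStep_path h3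
      rw [hx, mul_assoc, mul_assoc]
      have := (h1.mono fun _ _ _ h => h.1).trans
        (.step h2 (hp.trans (h4.mono fun _ _ _ h => h.1)))
      simpa only [mul_assoc] using this

/-- Until along blocks, expressed by until along single steps: a condition on block starts is
tested on the `c`-step that precedes them. -/
theorem untilOn_blockStep_iff (hR : DetStep R) {D E : Set W} {w : W} :
    UntilOn (blockStep R c) D E w ↔ w ∈ E ∨ w ∈ D ∧
      UntilOn R ((⋃ b : ({c}ᶜ : Set M), nextSet R b.1 Set.univ) ∪ nextSet R c D)
        (nextSet R c E) w := by
  set F := (⋃ b : ({c}ᶜ : Set M), nextSet R b.1 Set.univ) ∪ nextSet R c D with hF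
  have extend : ∀ {w w₁ : W} {t : M}, PathOf (avoidStep R c) w t w₁ →
      UntilOn R F (nextSet R c E) w₁ → UntilOn R F (nextSet R c E) w := by
    intro w w₁ t h
    induction h with
    | refl => exact id
    | step h _ ih =>
      intro hu
      exact .step (.inl (Set.mem_iUnion.2 ⟨⟨_, h.2⟩, _, h.1, trivial⟩)) h.1 (ih hu)
  constructor
  · intro h
    induction h with
    | base h => exact .inl h
    | step hw hb _ ih =>
      obtain ⟨t, w₁, ht, hc, hx⟩ := hb
      right
      rcases ih with ih | ⟨hD, hU⟩
      · exact ⟨hw, extend ht (.base ⟨_, hc, ih⟩)⟩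
      · exact ⟨hw, extend ht (.step (.inr ⟨_, hc, hD⟩) hc hU)⟩
  · rintro (h | ⟨hD, hU⟩)
    · exact .base h
    · have key : ∀ v, UntilOn R F (nextSet R c E) v → ∃ t w₁ w', PathOf (avoidStep R c) v t w₁ ∧
          R w₁ c w' ∧ UntilOn (blockStep R c) D E w' := by
        intro v hv
        induction hv with
        | base h =>
          obtain ⟨w', hc, hE⟩ := h
          exact ⟨1, _, w', .refl _, hc, .base hE⟩
        | step hF hR' _ ih =>
          obtain ⟨t, w₁, w', ht, hc, hu⟩ := ih
          rcases hF with hF | ⟨v', hv', hD'⟩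
          · obtain ⟨⟨b, hb⟩, v', hv', -⟩ := Set.mem_iUnion.1 hF
            obtain ⟨rfl, rfl⟩ := hR hv' hR'
            exact ⟨_, w₁, w', .step ⟨hR', hb⟩ ht, hc, hu⟩
          · obtain ⟨rfl, rfl⟩ := hR hv' hR'
            refine ⟨1, _, v', .refl _, hv', .step (a := ⟨c * t * c, ?_, ?_⟩) hD'
              ⟨t, w₁, ht, hc, rfl⟩ hu⟩
            · exact ⟨t * c, mul_assoc ..⟩
            · exact ⟨c * t, rfl⟩
      obtain ⟨t, w₁, w', ht, hc, hu⟩ := key _ hU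
      exact .step (a := ⟨c * t * c, ⟨t * c, mul_assoc ..⟩, ⟨c * t, rfl⟩⟩) hD ⟨t, w₁, ht, hc, rfl⟩ hu

end Blocks

/-- The states from which a state of `Θ` is reached by a path with product `m`. -/
def reachSet {W : Type v} {M : Type u} [Monoid M] (R : W → M → W → Prop) (m : M) (Θ : Set W) :
    Set W :=
  {w | ∃ w' ∈ Θ, PathOf R w m w'}

/-- The block steps of a temporal class are again steps of it, once reachability along paths
avoiding `c` stays within the class. -/
theorem TemporalClass.blockStep {W : Type v} {M : Type u} [Monoid M] [Finite M]
    {R : W → M → W → Prop} {𝒟 : Set (Set W)} (h𝒟 : TemporalClass R 𝒟) (hR : DetStep R) {c : M}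
    (hB : ∀ m, ∀ Θ ∈ 𝒟, reachSet (avoidStep R c) m Θ ∈ 𝒟) :
    TemporalClass (blockStep R c) 𝒟 where
  univ_mem := h𝒟.univ_mem
  empty_mem := h𝒟.empty_mem
  union_mem := h𝒟.union_mem
  inter_mem := h𝒟.inter_mem
  next_mem := by
    intro x D hD
    have := h𝒟.iUnion_mem (ι := {t : M // x.1 = c * t * c})
      (fun t => hB t.1 _ (h𝒟.next_mem c hD))
    convert this using 1
    ext w
    simp only [nextSet, reachSet, _root_.blockStep, Set.mem_iUnion, Set.mem_ofPred_eq]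
    constructor
    · rintro ⟨w', ⟨t, w₁, ht, hc, hx⟩, hD⟩
      exact ⟨⟨t, hx⟩, w₁, ⟨w', hc, hD⟩, ht⟩
    · rintro ⟨⟨t, hx⟩, w₁, ⟨w', hc, hD⟩, ht⟩
      exact ⟨w', ⟨t, w₁, ht, hc, hx⟩, hD⟩
  until_mem := by
    intro D E hD hE
    have h₁ : (⋃ b : ({c}ᶜ : Set M), nextSet R b.1 Set.univ) ∈ 𝒟 :=
      h𝒟.iUnion_mem fun b => h𝒟.next_mem _ h𝒟.univ_mem
    have h₂ := h𝒟.union_mem hE (h𝒟.inter_mem hD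
      (h𝒟.until_mem (h𝒟.union_mem h₁ (h𝒟.next_mem c hD)) (h𝒟.next_mem c hE)))
    convert h₂ using 1
    ext w
    exact untilOn_blockStep_iff hR

/-- Reachability by a path with a prescribed product in a finite aperiodic monoid stays within a
temporal class. The induction is on the size of the monoid and on the number of labels in use:
removing a label `c ≠ 1` decreases the latter, passing to blocks delimited by `c` replaces the
monoid by its local divisor at `c`. -/
theorem reachSet_mem_of_card_le {W : Type v} {𝒟 : Set (Set W)} (n : ℕ) :
    ∀ (M : Type u) [Monoid M] [Finite M], Nat.card M ≤ n → (∀ x : M, ∃ k, x ^ k = x ^ (k + 1)) →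
      ∀ (s : ℕ) (A : Set M), A.ncard ≤ s → ∀ R : W → M → W → Prop, DetStep R →
      TemporalClass R 𝒟 → (∀ w a w', R w a w' → a ∈ A) → ∀ m, ∀ Θ ∈ 𝒟, reachSet R m Θ ∈ 𝒟 := by
  induction n with
  | zero =>
    intro M _ _ hn
    exact absurd (Nat.card_pos (α := M)) (by omega)
  | succ n ihn =>
    intro M _ _ hn hM s
    induction s with
    | zero =>
      intro A hA R hR h𝒟 hRA m Θ hΘ
      have hA : A = ∅ := (Set.ncard_eq_zero A.toFinite).1 (by omega)
      subst hA
      by_cases hm : m = 1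
      · convert hΘ using 1
        ext w
        constructor
        · rintro ⟨w', hw', hp⟩
          cases hp with
          | refl => exact hw'
          | step h _ => exact (hRA _ _ _ h).elim
        · intro h
          subst hm
          exact ⟨w, h, .refl _⟩
      · convert h𝒟.empty_mem using 1
        ext w
        simp only [Set.mem_empty_iff_false, iff_false]
        rintro ⟨w', hw', hp⟩
        cases hp with
        | refl => exact hm rfl
        | step h _ => exact (hRA _ _ _ h).elim
    | succ s ihs =>
      intro A hA R hR h𝒟 hRA m Θ hΘ
      by_cases hc : ∃ c ∈ A, c ≠ 1
      · obtain ⟨c, hcA, hc⟩ := hc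
        have hB : ∀ m, ∀ Θ ∈ 𝒟, reachSet (avoidStep R c) m Θ ∈ 𝒟 := by
          refine ihs (A \ {c}) ?_ (avoidStep R c) (fun _ _ _ _ _ h h' => hR h.1 h'.1)
            (h𝒟.restrict hR _) (fun w a w' h => ⟨hRA _ _ _ h.1, h.2⟩)
          have := Set.ncard_sdiff_singleton_lt_of_mem hcA A.toFinite
          omega
        have hlt := LocalDivisor.card_lt hM hc
        have hD : ∀ x, ∀ Θ ∈ 𝒟, reachSet (blockStep R c) x Θ ∈ 𝒟 :=
          ihn (LocalDivisor c) (by omega) (LocalDivisor.aperiodic hM) _ Set.univ le_rfl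
            (blockStep R c) (blockStep_det hR) (h𝒟.blockStep hR hB) (fun _ _ _ _ => trivial)
        have := h𝒟.union_mem (hB m Θ hΘ)
          (h𝒟.iUnion_mem (ι := {y : M × LocalDivisor c × M // m = y.1 * y.2.1.1 * y.2.2})
            (fun y => hB y.1.1 _ (h𝒟.next_mem c (hD y.1.2.1 _ (hB y.1.2.2 Θ hΘ)))))
        convert this using 1
        ext w
        simp only [reachSet, nextSet, Set.mem_union, Set.mem_iUnion, Set.mem_ofPred_eq]
        constructor
        · rintro ⟨w', hw', hp⟩
          rcases (path_iff_blocks (c := c)).1 hp with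
            h | ⟨t, x, s, w₁, w₂, w₃, h1, h2, h3, h4, hm⟩
          · exact .inl ⟨w', hw', h⟩
          · exact .inr ⟨⟨(t, x, s), hm⟩, w₁, ⟨w₂, h2, w₃, ⟨w', hw', h4⟩, h3⟩, h1⟩
        · rintro (⟨w', hw', h⟩ | ⟨⟨⟨t, x, s⟩, hm⟩, w₁, ⟨w₂, h2, w₃, ⟨w', hw', h4⟩, h3⟩, h1⟩)
          · exact ⟨w', hw', path_iff_blocks.2 (.inl h)⟩
          · exact ⟨w', hw', path_iff_blocks.2 (.inr ⟨t, x, s, w₁, w₂, w₃, h1, h2, h3, h4, hm⟩)⟩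
      · push Not at hc
        -- all labels are `1`, so every path has product `1`
        have hone : ∀ {w m w'}, PathOf R w m w' → m = 1 := by
          intro w m w' h
          induction h with
          | refl => rfl
          | step h _ ih => rw [ih, hc _ (hRA _ _ _ h), mul_one]
        by_cases hm : m = 1
        · subst hm
          convert h𝒟.until_mem h𝒟.univ_mem hΘ using 1
          ext w
          constructor
          · rintro ⟨w', hw', hp⟩
            generalize hm : (1 : M) = m at hp
            clear hm
            induction hp with
            | refl => exact .base hw'
            | step h _ ih => exact UntilOn.step trivial h (ih hw')
          · intro h
            change UntilOn R _ _ w at h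
            induction h with
            | base h => exact ⟨_, h, .refl _⟩
            | step _ h _ ih =>
              obtain ⟨w', hw', hp⟩ := ih
              have hp' := PathOf.step h hp
              rw [hc _ (hRA _ _ _ h), mul_one] at hp'
              exact ⟨w', hw', hp'⟩
        · convert h𝒟.empty_mem using 1
          ext w
          simp only [Set.mem_empty_iff_false, iff_false]
          rintro ⟨w', hw', hp⟩
          exact hm (hone hp)

theorem TemporalClass.reachSet_mem {W : Type v} {M : Type u} [Monoid M] [Finite M]
    {R : W → M → W → Prop} {𝒟 : Set (Set W)} (h𝒟 : TemporalClass R 𝒟) (hR : DetStep R)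
    (hM : ∀ x : M, ∃ k, x ^ k = x ^ (k + 1)) (m : M) {Θ : Set W} (hΘ : Θ ∈ 𝒟) :
    reachSet R m Θ ∈ 𝒟 :=
  reachSet_mem_of_card_le _ M le_rfl hM _ Set.univ le_rfl R hR h𝒟 (fun _ _ _ _ => trivial) m Θ hΘ

/-! ### Ehrenfeucht–Fraïssé types of words -/

/-- The possible rank-`k` types of words over the colours `C`. -/
def WordType (C : Type u) : ℕ → Type u
  | 0 => PUnit
  | k + 1 => Set (WordType C k × C × WordType C k)

instance WordType.finite (C : Type u) [Finite C] : ∀ k, Finite (WordType C k)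
  | 0 => inferInstanceAs (Finite PUnit)
  | k + 1 =>
    have := WordType.finite C k
    inferInstanceAs (Finite (Set (WordType C k × C × WordType C k)))

/-- The rank-`k` type of a word whose letters are coloured by `col`: at rank `k + 1` it records,
for every position, the rank-`k` types of the words to its left and right and its colour. -/
def wordType {A : Type v} {C : Type u} (col : A → C) : (k : ℕ) → List A → WordType C k
  | 0, _ => PUnit.unit
  | k + 1, w =>
    {t | ∃ u a v, w = u ++ a :: v ∧ t = (wordType col k u, col a, wordType col k v)}

/-- The one-sided comparison of words that are open to the right: every position of the first
can be matched in the second, with the same type to its left, the same colour, and a comparable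
word to its right. -/
def TailLE {A : Type v} {C : Type u} (col : A → C) : ℕ → List A → List A → Prop
  | 0, _, _ => True
  | k + 1, w, w' => ∀ u a v, w = u ++ a :: v → ∃ u' a' v', w' = u' ++ a' :: v' ∧
      wordType col k u = wordType col k u' ∧ col a = col a' ∧ TailLE col k v v'

theorem List.append_eq_append_cons_iff' {A : Type v} {u v p q : List A} {a : A} :
    u ++ v = p ++ a :: q ↔
      (∃ r, u = p ++ a :: r ∧ q = r ++ v) ∨ ∃ r, p = u ++ r ∧ v = r ++ a :: q := by
  constructor
  · intro h
    rcases List.append_eq_append_iff.1 h with ⟨r, h1, h2⟩ | ⟨r, h1, h2⟩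
    · exact .inr ⟨r, h1, h2⟩
    · cases r with
      | nil => exact .inr ⟨[], by simpa using h1.symm, by simpa using h2.symm⟩
      | cons b r =>
        obtain ⟨rfl, h3⟩ := List.cons.inj h2
        exact .inl ⟨r, h1, h3⟩
  · rintro (⟨r, rfl, rfl⟩ | ⟨r, rfl, rfl⟩) <;> simp

section Types

variable {A : Type v} {C : Type u} {col : A → C} {k : ℕ}

theorem exists_split_of_wordType_eq {w w' u v : List A} {a : A}
    (h : wordType col (k + 1) w = wordType col (k + 1) w') (hw : w = u ++ a :: v) :
    ∃ u' a' v', w' = u' ++ a' :: v' ∧ wordType col k u = wordType col k u' ∧ col a = col a' ∧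
      wordType col k v = wordType col k v' := by
  have hmem : ((wordType col k u, col a, wordType col k v) : _ × _ × _) ∈
      (show Set (WordType C k × C × WordType C k) from wordType col (k + 1) w) :=
    ⟨u, a, v, hw, rfl⟩
  rw [h] at hmem
  obtain ⟨u', a', v', hw', ht⟩ := hmem
  simp only [Prod.mk.injEq] at ht
  exact ⟨u', a', v', hw', ht.1, ht.2.1, ht.2.2⟩

theorem wordType_eq_of_splits {w w' : List A}
    (h : ∀ u a v, w = u ++ a :: v → ∃ u' a' v', w' = u' ++ a' :: v' ∧
      wordType col k u = wordType col k u' ∧ col a = col a' ∧ wordType col k v = wordType col k v')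
    (h' : ∀ u a v, w' = u ++ a :: v → ∃ u' a' v', w = u' ++ a' :: v' ∧
      wordType col k u = wordType col k u' ∧ col a = col a' ∧
      wordType col k v = wordType col k v') :
    wordType col (k + 1) w = wordType col (k + 1) w' := by
  apply Set.ext
  intro t
  constructor
  · rintro ⟨u, a, v, hw, rfl⟩
    obtain ⟨u', a', v', hw', h1, h2, h3⟩ := h u a v hw
    exact ⟨u', a', v', hw', by rw [h1, h2, h3]⟩
  · rintro ⟨u, a, v, hw, rfl⟩
    obtain ⟨u', a', v', hw', h1, h2, h3⟩ := h' u a v hw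
    exact ⟨u', a', v', hw', by rw [h1, h2, h3]⟩

theorem wordType_eq_of_succ {w w' : List A} (h : wordType col (k + 1) w = wordType col (k + 1) w') :
    wordType col k w = wordType col k w' := by
  induction k generalizing w w' with
  | zero => rfl
  | succ k ih =>
    refine wordType_eq_of_splits (fun u a v hw => ?_) (fun u a v hw => ?_)
    · obtain ⟨u', a', v', hw', h1, h2, h3⟩ := exists_split_of_wordType_eq h hw
      exact ⟨u', a', v', hw', ih h1, h2, ih h3⟩
    · obtain ⟨u', a', v', hw', h1, h2, h3⟩ := exists_split_of_wordType_eq h.symm hw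
      exact ⟨u', a', v', hw', ih h1, h2, ih h3⟩

theorem TailLE.of_succ {w w' : List A} (h : TailLE col (k + 1) w w') : TailLE col k w w' := by
  induction k generalizing w w' with
  | zero => trivial
  | succ k ih =>
    intro u a v hw
    obtain ⟨u', a', v', hw', h1, h2, h3⟩ := h u a v hw
    exact ⟨u', a', v', hw', wordType_eq_of_succ h1, h2, ih h3⟩

theorem TailLE.refl {w : List A} : TailLE col k w w := by
  induction k generalizing w with
  | zero => trivial
  | succ k ih => exact fun u a v hw => ⟨u, a, v, hw, rfl, rfl, ih⟩

theorem wordType_append {u u' v v' : List A} (hu : wordType col k u = wordType col k u')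
    (hv : wordType col k v = wordType col k v') :
    wordType col k (u ++ v) = wordType col k (u' ++ v') := by
  induction k generalizing u u' v v' with
  | zero => rfl
  | succ k ih =>
    have half : ∀ {u u' v v' : List A}, wordType col (k + 1) u = wordType col (k + 1) u' →
        wordType col (k + 1) v = wordType col (k + 1) v' →
        ∀ p a q, u ++ v = p ++ a :: q → ∃ p' a' q', u' ++ v' = p' ++ a' :: q' ∧
          wordType col k p = wordType col k p' ∧ col a = col a' ∧
          wordType col k q = wordType col k q' := by
      intro u u' v v' hu hv p a q h
      rcases List.append_eq_append_cons_iff'.1 h with ⟨r, rfl, rfl⟩ | ⟨r, rfl, rfl⟩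
      · obtain ⟨p', a', r', rfl, h1, h2, h3⟩ := exists_split_of_wordType_eq hu rfl
        exact ⟨p', a', r' ++ v', by simp, h1, h2, ih h3 (wordType_eq_of_succ hv)⟩
      · obtain ⟨r', a', q', rfl, h1, h2, h3⟩ := exists_split_of_wordType_eq hv rfl
        exact ⟨u' ++ r', a', q', by simp, ih (wordType_eq_of_succ hu) h1, h2, h3⟩
    exact wordType_eq_of_splits (half hu hv) (half hu.symm hv.symm)

theorem TailLE.append {u u' v v' : List A} (hu : wordType col k u = wordType col k u')
    (hv : TailLE col k v v') : TailLE col k (u ++ v) (u' ++ v') := by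
  induction k generalizing u u' v v' with
  | zero => trivial
  | succ k ih =>
    intro p a q h
    rcases List.append_eq_append_cons_iff'.1 h with ⟨r, rfl, rfl⟩ | ⟨r, rfl, rfl⟩
    · obtain ⟨p', a', r', rfl, h1, h2, h3⟩ := exists_split_of_wordType_eq hu rfl
      exact ⟨p', a', r' ++ v', by simp, h1, h2, ih h3 hv.of_succ⟩
    · obtain ⟨r', a', q', rfl, h1, h2, h3⟩ := hv _ _ _ rfl
      exact ⟨u' ++ r', a', q', by simp, wordType_append (wordType_eq_of_succ hu) h1, h2, h3⟩

theorem wordType_singleton {a b : A} (h : col a = col b) :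
    wordType col k [a] = wordType col k [b] := by
  have half : ∀ {k : ℕ} {a b : A}, col a = col b → ∀ u c v, [a] = u ++ c :: v →
      ∃ u' c' v', [b] = u' ++ c' :: v' ∧ wordType col k u = wordType col k u' ∧ col c = col c' ∧
        wordType col k v = wordType col k v' := by
    intro k a b h u c v hw
    obtain ⟨rfl, h'⟩ : u = [] ∧ [a] = c :: v := by
      cases u with
      | nil => simpa using hw
      | cons x u => simp at hw
    obtain ⟨rfl, rfl⟩ := List.cons.inj h'
    exact ⟨[], b, [], by simp, rfl, h, rfl⟩
  cases k with
  | zero => rfl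
  | succ k => exact wordType_eq_of_splits (half h) (half h.symm)

theorem wordType_cons {a b : A} {u v : List A} (h : col a = col b)
    (huv : wordType col k u = wordType col k v) :
    wordType col k (a :: u) = wordType col k (b :: v) :=
  wordType_append (wordType_singleton h) huv

theorem TailLE.cons {a b : A} {u v : List A} (h : col a = col b) (huv : TailLE col k u v) :
    TailLE col k (a :: u) (b :: v) :=
  TailLE.append (wordType_singleton h) huv

/-! ### The monoid of types is finite and aperiodic -/

/-- The `n`-fold repetition of a word. -/
def List.repeatWord (u : List A) : ℕ → List A
  | 0 => []
  | n + 1 => u ++ List.repeatWord u n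

theorem List.repeatWord_add (u : List A) (m n : ℕ) :
    u.repeatWord (m + n) = u.repeatWord m ++ u.repeatWord n := by
  induction m with
  | zero => simp [List.repeatWord]
  | succ m ih => rw [Nat.succ_add]; simp [List.repeatWord, ih]

theorem List.repeatWord_eq_append_cons_iff {u x y : List A} {a : A} {n : ℕ} :
    u.repeatWord n = x ++ a :: y ↔ ∃ i j p q, i + j + 1 = n ∧ u = p ++ a :: q ∧
      x = u.repeatWord i ++ p ∧ y = q ++ u.repeatWord j := by
  constructor
  · intro h
    induction n generalizing x with
    | zero => simp [List.repeatWord] at h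
    | succ n ih =>
      rcases List.append_eq_append_cons_iff'.1 h with ⟨r, h1, h2⟩ | ⟨r, rfl, h2⟩
      · exact ⟨0, n, x, r, by omega, h1, by simp [List.repeatWord], h2⟩
      · obtain ⟨i, j, p, q, h1, h3, rfl, h5⟩ := ih h2
        exact ⟨i + 1, j, p, q, by omega, h3, by simp [List.repeatWord], h5⟩
  · rintro ⟨i, j, p, q, rfl, hu, rfl, rfl⟩
    rw [add_assoc, List.repeatWord_add, add_comm j]
    conv_lhs => rw [List.repeatWord_add u 1 j]
    simp only [List.repeatWord, List.append_nil, List.append_assoc]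
    congr 1
    conv_lhs => enter [1]; rw [hu]
    simp

/-- Types do not distinguish high powers of a word: a position in one power is matched by dropping
or adding a copy of the word on its longer side. -/
theorem wordType_repeatWord (u : List A) {n : ℕ} (hn : 2 ^ k ≤ n + 1) :
    wordType col k (u.repeatWord n) = wordType col k (u.repeatWord (n + 1)) := by
  induction k generalizing n with
  | zero => rfl
  | succ k ih =>
    rw [pow_succ] at hn
    refine wordType_eq_of_splits (fun x a y h => ?_) (fun x a y h => ?_)
    · obtain ⟨i, j, p, q, hij, hu, rfl, rfl⟩ := List.repeatWord_eq_append_cons_iff.1 h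
      rcases le_or_gt (2 ^ k) (i + 1) with hi | hi
      · exact ⟨u.repeatWord (i + 1) ++ p, a, q ++ u.repeatWord j,
          List.repeatWord_eq_append_cons_iff.2 ⟨i + 1, j, p, q, by omega, hu, rfl, rfl⟩,
          wordType_append (ih hi) rfl, rfl, rfl⟩
      · exact ⟨u.repeatWord i ++ p, a, q ++ u.repeatWord (j + 1),
          List.repeatWord_eq_append_cons_iff.2 ⟨i, j + 1, p, q, by omega, hu, rfl, rfl⟩,
          rfl, rfl, wordType_append rfl (ih (by omega))⟩
    · obtain ⟨i, j, p, q, hij, hu, rfl, rfl⟩ := List.repeatWord_eq_append_cons_iff.1 h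
      rcases le_or_gt (2 ^ k) i with hi | hi
      · obtain ⟨i, rfl⟩ : ∃ i', i = i' + 1 :=
          ⟨i - 1, by have := Nat.one_le_two_pow (n := k); omega⟩
        exact ⟨u.repeatWord i ++ p, a, q ++ u.repeatWord j,
          List.repeatWord_eq_append_cons_iff.2 ⟨i, j, p, q, by omega, hu, rfl, rfl⟩,
          wordType_append (ih hi).symm rfl, rfl, rfl⟩
      · obtain ⟨j, rfl⟩ : ∃ j', j = j' + 1 :=
          ⟨j - 1, by have := Nat.one_le_two_pow (n := k); omega⟩
        exact ⟨u.repeatWord i ++ p, a, q ++ u.repeatWord j,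
          List.repeatWord_eq_append_cons_iff.2 ⟨i, j, p, q, by omega, hu, rfl, rfl⟩,
          rfl, rfl, wordType_append rfl (ih (by omega)).symm⟩

variable (col k) in
/-- Equality of rank-`k` types, as a congruence on words. -/
def typeCon : Con (FreeMonoid A) where
  r u v := wordType col k u.toList = wordType col k v.toList
  iseqv := ⟨fun _ => rfl, fun h => h.symm, fun h h' => h.trans h'⟩
  mul' h h' := by
    simp only [FreeMonoid.toList_mul]
    exact wordType_append h h'

variable (col k) in
/-- The class of a word in the monoid of rank-`k` types. -/
def typeMk (u : List A) : (typeCon col k).Quotient := ((FreeMonoid.ofList u : FreeMonoid A) :)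

theorem typeMk_eq_iff {u v : List A} :
    typeMk col k u = typeMk col k v ↔ wordType col k u = wordType col k v :=
  (typeCon col k).eq

theorem typeMk_append (u v : List A) : typeMk col k (u ++ v) = typeMk col k u * typeMk col k v :=
  rfl

theorem typeMk_surjective : Function.Surjective (typeMk col k) := fun x =>
  Con.induction_on x fun w => ⟨w.toList, rfl⟩

instance [Finite C] : Finite (typeCon col k).Quotient := by
  have hs := typeMk_surjective (col := col) (k := k)
  refine Finite.of_injective (fun x => wordType col k (hs x).choose) fun x y h => ?_
  rw [← (hs x).choose_spec, ← (hs y).choose_spec]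
  exact typeMk_eq_iff.2 h

theorem typeCon_aperiodic (x : (typeCon col k).Quotient) : ∃ n, x ^ n = x ^ (n + 1) := by
  obtain ⟨u, rfl⟩ := typeMk_surjective x
  have key : ∀ n, typeMk col k u ^ n = typeMk col k (u.repeatWord n) := by
    intro n
    induction n with
    | zero => rfl
    | succ n ih => rw [pow_succ', ih, List.repeatWord, typeMk_append]
  exact ⟨2 ^ k, by rw [key, key, typeMk_eq_iff]; exact wordType_repeatWord u (Nat.le_succ _)⟩

/-! ### Temporal classes of languages -/

variable (col) in
/-- Reading the first letter of a word, labelled by its colour. -/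
def colorStep : List A → C → List A → Prop := fun w c w' => ∃ a, w = a :: w' ∧ c = col a

variable (col k) in
/-- Reading the first letter of a word, labelled by its rank-`k` type. -/
def typeStep : List A → (typeCon col k).Quotient → List A → Prop :=
  fun w m w' => ∃ a, w = a :: w' ∧ m = typeMk col k [a]

theorem typeStep_det : DetStep (typeStep col k) := by
  rintro w m m' w₁ w₂ ⟨a, rfl, rfl⟩ ⟨b, h, rfl⟩
  obtain ⟨rfl, rfl⟩ := List.cons.inj h
  exact ⟨rfl, rfl⟩

theorem typeStep_path_iff {w w' : List A} {m : (typeCon col k).Quotient} :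
    PathOf (typeStep col k) w m w' ↔ ∃ u, w = u ++ w' ∧ m = typeMk col k u := by
  constructor
  · intro h
    induction h with
    | refl w => exact ⟨[], rfl, rfl⟩
    | step h _ ih =>
      obtain ⟨a, rfl, rfl⟩ := h
      obtain ⟨u, rfl, rfl⟩ := ih
      exact ⟨a :: u, rfl, (typeMk_append [a] u).symm⟩
  · rintro ⟨u, rfl, rfl⟩
    induction u with
    | nil => exact .refl _
    | cons a u ih => exact .step (w' := u ++ w') ⟨a, rfl, rfl⟩ ih

theorem untilOn_colorStep_iff {D E : Set (List A)} {w : List A} :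
    UntilOn (colorStep col) D E w ↔ UntilOn (typeStep col k) D E w := by
  constructor
  · intro h
    induction h with
    | base h => exact .base h
    | step hD h _ ih =>
      obtain ⟨a, ha, -⟩ := h
      exact .step hD ⟨a, ha, rfl⟩ ih
  · intro h
    induction h with
    | base h => exact .base h
    | step hD h _ ih =>
      obtain ⟨a, ha, -⟩ := h
      exact .step hD ⟨a, ha, rfl⟩ ih

theorem TemporalClass.typeStep [Finite C] {𝒟 : Set (Set (List A))}
    (h𝒟 : TemporalClass (colorStep col) 𝒟) : TemporalClass (typeStep col k) 𝒟 where
  univ_mem := h𝒟.univ_mem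
  empty_mem := h𝒟.empty_mem
  union_mem := h𝒟.union_mem
  inter_mem := h𝒟.inter_mem
  next_mem := by
    intro m D hD
    convert h𝒟.iUnion_mem (ι := {c : C // ∃ a, c = col a ∧ m = typeMk col k [a]})
      (fun c => h𝒟.next_mem c.1 hD) using 1
    ext w
    simp only [nextSet, Set.mem_iUnion, Set.mem_ofPred_eq]
    constructor
    · rintro ⟨w', ⟨a, rfl, hm⟩, hD⟩
      exact ⟨⟨col a, a, rfl, hm⟩, w', ⟨a, rfl, rfl⟩, hD⟩
    · rintro ⟨⟨_, a, rfl, hm⟩, w', ⟨b, rfl, hb⟩, hD⟩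
      exact ⟨w', ⟨b, rfl, hm.trans (typeMk_eq_iff.2 (wordType_singleton hb))⟩, hD⟩
  until_mem := by
    intro D E hD hE
    convert h𝒟.until_mem hD hE using 1
    ext w
    exact untilOn_colorStep_iff.symm

/-- A temporal class of languages is closed under prefixing all words of a given type. -/
theorem TemporalClass.typed_append_mem [Finite C] {𝒟 : Set (Set (List A))}
    (h𝒟 : TemporalClass (colorStep col) 𝒟) (τ : WordType C k) {Θ : Set (List A)} (hΘ : Θ ∈ 𝒟) :
    {w | ∃ u v, w = u ++ v ∧ wordType col k u = τ ∧ v ∈ Θ} ∈ 𝒟 := by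
  by_cases hτ : ∃ u, wordType col k u = τ
  · obtain ⟨u₀, rfl⟩ := hτ
    convert (h𝒟.typeStep (k := k)).reachSet_mem typeStep_det typeCon_aperiodic
      (typeMk col k u₀) hΘ using 1
    ext w
    simp only [reachSet, typeStep_path_iff, typeMk_eq_iff, Set.mem_ofPred_eq]
    constructor
    · rintro ⟨u, v, rfl, hu, hv⟩
      exact ⟨v, hv, u, rfl, hu.symm⟩
    · rintro ⟨v, hv, u, rfl, hu⟩
      exact ⟨u, v, rfl, hu.symm, hv⟩
  · convert h𝒟.empty_mem using 1
    ext w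
    simp only [Set.mem_ofPred_eq, Set.mem_empty_iff_false, iff_false]
    rintro ⟨u, v, -, hu, -⟩
    exact hτ ⟨u, hu⟩

/-- The up-sets of the one-sided comparison are finitely many at each rank, and belong to every
temporal class: at rank `k + 1` such an up-set is an intersection of languages "a word of type
`τ`, a letter of colour `c`, then a word of the rank-`k` up-set `U`", one for each position of the
word that generates it. -/
theorem upSet_finite_and_mem [Finite C] {𝒟 : Set (Set (List A))}
    (h𝒟 : TemporalClass (colorStep col) 𝒟) (k : ℕ) :
    (Set.range fun w => {w' | TailLE col k w w'}).Finite ∧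
      ∀ w, {w' | TailLE col k w w'} ∈ 𝒟 := by
  induction k with
  | zero =>
    have h : ∀ w : List A, {w' | TailLE col 0 w w'} = Set.univ := fun w => by
      ext; simp [TailLE]
    simp only [h]
    exact ⟨Set.finite_range_const, fun _ => h𝒟.univ_mem⟩
  | succ k ih =>
    obtain ⟨hfin, hmem⟩ := ih
    set U : List A → Set (List A) := fun w => {w' | TailLE col k w w'} with hU
    let G : WordType C k × C × Set (List A) → Set (List A) := fun t =>
      {w | ∃ u v, w = u ++ v ∧ wordType col k u = t.1 ∧ v ∈ nextSet (colorStep col) t.2.1 t.2.2}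
    let T : List A → Set (WordType C k × C × Set (List A)) := fun w =>
      {t | ∃ u a v, w = u ++ a :: v ∧ t = (wordType col k u, col a, U v)}
    let all : Set (WordType C k × C × Set (List A)) := Set.univ ×ˢ Set.univ ×ˢ Set.range U
    have hall : all.Finite := Set.finite_univ.prod (Set.finite_univ.prod hfin)
    have hT : ∀ w, T w ⊆ all := by
      rintro w _ ⟨u, a, v, -, rfl⟩
      exact ⟨trivial, trivial, v, rfl⟩
    have hEq : ∀ w, {w' | TailLE col (k + 1) w w'} = ⋂₀ (G '' T w) := by
      intro w
      ext w'
      simp only [TailLE, Set.mem_ofPred_eq, Set.sInter_image, Set.mem_iInter]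
      constructor
      · rintro h _ ⟨u, a, v, hw, rfl⟩
        obtain ⟨u', a', v', hw', h1, h2, h3⟩ := h u a v hw
        exact ⟨u', a' :: v', hw', h1.symm, v', ⟨a', rfl, h2⟩, h3⟩
      · rintro h u a v hw
        obtain ⟨u', _, hw', h1, v', ⟨a', rfl, h2⟩, h3⟩ := h _ ⟨u, a, v, hw, rfl⟩
        exact ⟨u', a', v', hw', h1.symm, h2, h3⟩
    simp only [hEq]
    refine ⟨(hall.finite_subsets.image fun T => ⋂₀ (G '' T)).subset ?_, fun w => ?_⟩
    · rintro _ ⟨w, rfl⟩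
      exact ⟨T w, hT w, rfl⟩
    · refine h𝒟.sInter_mem ((hall.subset (hT w)).image G) ?_
      rintro _ ⟨_, ⟨u, a, v, -, rfl⟩, rfl⟩
      exact h𝒟.typed_append_mem _ (h𝒟.next_mem _ (hmem v))

end Types

/-! ### Languages of coSafetyLTL without weak tomorrow -/

namespace LTL

variable {AP : Type u}

/-- Satisfaction depends only on the suffix of the word that starts at the given position. -/
theorem sat_cons (a : Set AP) (σ : List (Set AP)) (φ : LTL AP) (i : Fin σ.length) :
    Sat (a :: σ) φ (Fin.succ i : Fin (σ.length + 1)) ↔ Sat σ φ i := by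
  induction φ generalizing i with
  | atom p => rfl
  | not φ ih => exact not_congr (ih i)
  | or φ ψ ih₁ ih₂ => exact or_congr (ih₁ i) (ih₂ i)
  | and φ ψ ih₁ ih₂ => exact and_congr (ih₁ i) (ih₂ i)
  | next φ ih =>
    constructor
    · rintro ⟨h, hs⟩
      exact ⟨Nat.lt_of_succ_lt_succ h, (ih _).1 hs⟩
    · rintro ⟨h, hs⟩
      exact ⟨Nat.succ_lt_succ h, (ih _).2 hs⟩
  | weakNext φ ih =>
    constructor
    · intro hs h
      exact (ih _).1 (hs (Nat.succ_lt_succ h))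
    · intro hs h
      exact (ih _).2 (hs (Nat.lt_of_succ_lt_succ h))
  | untl φ ψ ih₁ ih₂ =>
    constructor
    · rintro ⟨j, hij, hj, hk⟩
      induction j using Fin.cases with
      | zero => exact absurd hij (Fin.succ_pos i).not_ge
      | succ j =>
        exact ⟨j, Fin.succ_le_succ_iff.1 hij, (ih₂ j).1 hj, fun k hik hkj =>
          (ih₁ k).1 (hk _ (Fin.succ_le_succ_iff.2 hik) (Fin.succ_lt_succ_iff.2 hkj))⟩
    · rintro ⟨j, hij, hj, hk⟩
      refine ⟨Fin.succ j, Fin.succ_le_succ_iff.2 hij, (ih₂ j).2 hj, fun k hik hkj => ?_⟩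
      induction k using Fin.cases with
      | zero => exact absurd hik (Fin.succ_pos i).not_ge
      | succ k =>
        exact (ih₁ k).2 (hk k (Fin.succ_le_succ_iff.1 hik) (Fin.succ_lt_succ_iff.1 hkj))
  | release φ ψ ih₁ ih₂ =>
    refine or_congr ⟨fun h j hij => ?_, fun h j hij => ?_⟩ ⟨?_, ?_⟩
    · exact (ih₂ j).1 (h _ (Fin.succ_le_succ_iff.2 hij))
    · induction j using Fin.cases with
      | zero => exact absurd hij (Fin.succ_pos i).not_ge
      | succ j => exact (ih₂ j).2 (h j (Fin.succ_le_succ_iff.1 hij))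
    · rintro ⟨k, hik, hk, hj⟩
      induction k using Fin.cases with
      | zero => exact absurd hik (Fin.succ_pos i).not_ge
      | succ k =>
        exact ⟨k, Fin.succ_le_succ_iff.1 hik, (ih₁ k).1 hk, fun j hij hjk =>
          (ih₂ j).1 (hj _ (Fin.succ_le_succ_iff.2 hij) (Fin.succ_le_succ_iff.2 hjk))⟩
    · rintro ⟨k, hik, hk, hj⟩
      refine ⟨Fin.succ k, Fin.succ_le_succ_iff.2 hik, (ih₁ k).2 hk, fun j hij hjk => ?_⟩
      induction j using Fin.cases with
      | zero => exact absurd hij (Fin.succ_pos i).not_ge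
      | succ j =>
        exact (ih₂ j).2 (hj j (Fin.succ_le_succ_iff.1 hij) (Fin.succ_le_succ_iff.1 hjk))

theorem cons_mem_langFin {a : Set AP} {σ : List (Set AP)} {φ : LTL AP} :
    a :: σ ∈ φ.langFin ↔ Sat (a :: σ) φ (0 : Fin (σ.length + 1)) :=
  ⟨fun ⟨_, h⟩ => h, fun h => ⟨Nat.succ_pos _, h⟩⟩

theorem nil_notMem_langFin {φ : LTL AP} : [] ∉ φ.langFin := fun ⟨h, _⟩ => absurd h (by simp)

theorem langFin_or (φ ψ : LTL AP) : (or φ ψ).langFin = φ.langFin ∪ ψ.langFin := by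
  ext σ
  cases σ with
  | nil => simp [nil_notMem_langFin]
  | cons a σ => simp only [Set.mem_union, cons_mem_langFin]; rfl

theorem langFin_and (φ ψ : LTL AP) : (and φ ψ).langFin = φ.langFin ∩ ψ.langFin := by
  ext σ
  cases σ with
  | nil => simp [nil_notMem_langFin]
  | cons a σ => simp only [Set.mem_inter_iff, cons_mem_langFin]; rfl

theorem cons_mem_langFin_atom {a : Set AP} {σ : List (Set AP)} {p : AP} :
    a :: σ ∈ (atom p).langFin ↔ p ∈ a := cons_mem_langFin

theorem cons_mem_langFin_notAtom {a : Set AP} {σ : List (Set AP)} {p : AP} :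
    a :: σ ∈ (not (atom p)).langFin ↔ p ∉ a := cons_mem_langFin

theorem cons_mem_langFin_next {a : Set AP} {σ : List (Set AP)} {φ : LTL AP} :
    a :: σ ∈ (next φ).langFin ↔ σ ∈ φ.langFin := by
  rw [cons_mem_langFin]
  constructor
  · rintro ⟨h, hs⟩
    have h' : 0 < σ.length := Nat.lt_of_succ_lt_succ h
    exact ⟨h', (sat_cons a σ φ ⟨0, h'⟩).1 hs⟩
  · rintro ⟨h, hs⟩
    exact ⟨Nat.succ_lt_succ h, (sat_cons a σ φ ⟨0, h⟩).2 hs⟩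

theorem cons_mem_langFin_untl {a : Set AP} {σ : List (Set AP)} {φ ψ : LTL AP} :
    a :: σ ∈ (untl φ ψ).langFin ↔ a :: σ ∈ ψ.langFin ∨
      a :: σ ∈ φ.langFin ∧ σ ∈ (untl φ ψ).langFin := by
  simp only [cons_mem_langFin]
  change (∃ j : Fin (σ.length + 1), _) ↔ _
  simp only [Fin.exists_fin_succ]
  change (_ ∧ _ ∧ (∀ k : Fin (σ.length + 1), _) ∨
    ∃ j : Fin σ.length, _ ∧ _ ∧ ∀ k : Fin (σ.length + 1), _) ↔ _
  simp only [Fin.forall_fin_succ, sat_cons]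
  apply or_congr
  · simp
  · constructor
    · rintro ⟨j, -, hj, h0, hk⟩
      exact ⟨h0 le_rfl (Fin.succ_pos j), j.pos, j, Nat.zero_le _, hj,
        fun k _ hkj => hk k (Fin.zero_le _) (Fin.succ_lt_succ_iff.2 hkj)⟩
    · rintro ⟨h0, h, j, -, hj, hk⟩
      exact ⟨j, Fin.zero_le _, hj, fun _ _ => h0,
        fun k _ hkj => hk k (Nat.zero_le _) (Fin.succ_lt_succ_iff.1 hkj)⟩

end LTL

section LTLClass

open LTL

variable {AP : Type u}

/-- The languages of coSafetyLTL without weak tomorrow, together with the language of all words.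
The latter contains the empty word, so it is not the language of a formula; it is needed because
the suffix after a mark may be empty. -/
def ltlClass (AP : Type u) : Set (Set (List (Set AP))) :=
  {S | S = Set.univ ∨ ∃ φ ∈ coSafetyLTLNoWeak AP, S = φ.langFin}

/-- The colour of a letter: the propositions of the finite set `P` that it contains. -/
def letterColor (P : Finset AP) (a : Set AP) : P → Prop := fun p => p.1 ∈ a

theorem langFin_mem_ltlClass {φ : LTL AP} (h : φ.IsCoSafety) (h' : φ.WeakNextFree) :
    φ.langFin ∈ ltlClass AP := .inr ⟨φ, ⟨h, h'⟩, rfl⟩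

theorem inter_mem_ltlClass {D E : Set (List (Set AP))} (hD : D ∈ ltlClass AP)
    (hE : E ∈ ltlClass AP) : D ∩ E ∈ ltlClass AP := by
  rcases hD with rfl | ⟨φ, hφ, rfl⟩
  · simpa using hE
  · rcases hE with rfl | ⟨ψ, hψ, rfl⟩
    · simpa using langFin_mem_ltlClass hφ.1 hφ.2
    · rw [← langFin_and]
      exact langFin_mem_ltlClass (.and hφ.1 hψ.1) ⟨hφ.2, hψ.2⟩

/-- Up to the empty word, every language of the class is defined by a formula. -/
theorem exists_formula_of_mem_ltlClass [Nonempty AP] {D : Set (List (Set AP))}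
    (hD : D ∈ ltlClass AP) :
    ∃ φ ∈ coSafetyLTLNoWeak AP, ∀ a σ, a :: σ ∈ φ.langFin ↔ a :: σ ∈ D := by
  rcases hD with rfl | ⟨φ, hφ, rfl⟩
  · obtain ⟨p⟩ := ‹Nonempty AP›
    refine ⟨or (atom p) (not (atom p)), ⟨.or (.atom p) (.notAtom p), trivial, trivial⟩, ?_⟩
    intro a σ
    rw [langFin_or, Set.mem_union, cons_mem_langFin_atom, cons_mem_langFin_notAtom]
    simp [em]
  · exact ⟨φ, hφ, fun _ _ => Iff.rfl⟩

theorem letters_mem_ltlClass [Nonempty AP] (P : Finset AP) (c : AP → Prop) :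
    {w | ∃ a σ, w = a :: σ ∧ ∀ p ∈ P, c p ↔ p ∈ a} ∈ ltlClass AP := by
  classical
  induction P using Finset.induction_on with
  | empty =>
    obtain ⟨φ, hφ, h⟩ := exists_formula_of_mem_ltlClass (AP := AP) (.inl rfl)
    refine .inr ⟨φ, hφ, ?_⟩
    ext w
    cases w with
    | nil => simp [nil_notMem_langFin]
    | cons a σ => simp [h]
  | insert p P _ ih =>
    have hp : {w : List (Set AP) | ∃ a σ, w = a :: σ ∧ (c p ↔ p ∈ a)} ∈ ltlClass AP := by
      by_cases hc : c p
      · refine .inr ⟨atom p, ⟨.atom p, trivial⟩, ?_⟩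
        ext w
        cases w with
        | nil => simp [nil_notMem_langFin]
        | cons a σ => simp [cons_mem_langFin_atom, hc]
      · refine .inr ⟨not (atom p), ⟨.notAtom p, trivial⟩, ?_⟩
        ext w
        cases w with
        | nil => simp [nil_notMem_langFin]
        | cons a σ => simp [cons_mem_langFin_notAtom, hc]
    convert inter_mem_ltlClass hp ih using 1
    ext w
    cases w <;> simp

theorem temporalClass_ltlClass [Nonempty AP] (P : Finset AP) :
    TemporalClass (colorStep (letterColor P)) (ltlClass AP) where
  univ_mem := .inl rfl
  empty_mem := by
    obtain ⟨p⟩ := ‹Nonempty AP›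
    refine .inr ⟨and (atom p) (not (atom p)), ⟨.and (.atom p) (.notAtom p), trivial, trivial⟩, ?_⟩
    ext w
    cases w with
    | nil => simp [nil_notMem_langFin]
    | cons a σ =>
      rw [langFin_and, Set.mem_inter_iff, cons_mem_langFin_atom, cons_mem_langFin_notAtom]
      simp
  union_mem := by
    rintro D E (rfl | ⟨φ, hφ, rfl⟩) hE
    · exact .inl (Set.univ_union E)
    · rcases hE with rfl | ⟨ψ, hψ, rfl⟩
      · exact .inl (Set.union_univ _)
      · rw [← langFin_or]
        exact langFin_mem_ltlClass (.or hφ.1 hψ.1) ⟨hφ.2, hψ.2⟩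
  inter_mem := inter_mem_ltlClass
  next_mem := by
    intro c D hD
    have hnext : {w : List (Set AP) | ∃ a σ, w = a :: σ ∧ σ ∈ D} ∈ ltlClass AP := by
      rcases hD with rfl | ⟨φ, hφ, rfl⟩
      · simpa using letters_mem_ltlClass ∅ fun _ => True
      · refine .inr ⟨next φ, ⟨.next hφ.1, hφ.2⟩, ?_⟩
        ext w
        cases w with
        | nil => simp [nil_notMem_langFin]
        | cons a σ => simp [cons_mem_langFin_next]
    convert inter_mem_ltlClass (letters_mem_ltlClass P fun p => ∃ h, c ⟨p, h⟩) hnext using 1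
    ext w
    cases w with
    | nil => simp [nextSet, colorStep]
    | cons a σ =>
      simp only [nextSet, colorStep, Set.mem_ofPred_eq, Set.mem_inter_iff, List.cons.injEq]
      constructor
      · rintro ⟨σ', ⟨b, ⟨rfl, rfl⟩, rfl⟩, hD⟩
        exact ⟨⟨a, σ, ⟨rfl, rfl⟩, fun p hp => ⟨fun h => h.2, fun h => ⟨hp, h⟩⟩⟩,
          a, σ, ⟨rfl, rfl⟩, hD⟩
      · rintro ⟨⟨b, τ, ⟨rfl, rfl⟩, hc⟩, b, τ, ⟨rfl, rfl⟩, hD⟩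
        refine ⟨σ, ⟨a, ⟨rfl, rfl⟩, funext fun p => propext ?_⟩, hD⟩
        rw [letterColor, ← hc p.1 p.2]
        exact ⟨fun h => ⟨p.2, h⟩, fun h => h.2⟩
  until_mem := by
    intro D E hD hE
    obtain ⟨φ, hφ, hφD⟩ := exists_formula_of_mem_ltlClass hD
    rcases hE with rfl | ⟨ψ, hψ, rfl⟩
    · exact .inl (Set.eq_univ_of_forall fun w => UntilOn.base trivial)
    · refine .inr ⟨untl φ ψ, ⟨.untl hφ.1 hψ.1, hφ.2, hψ.2⟩, ?_⟩
      ext w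
      constructor
      · intro h
        change UntilOn _ _ _ w at h
        induction h with
        | @base w h =>
          cases w with
          | nil => exact absurd h nil_notMem_langFin
          | cons a σ => exact cons_mem_langFin_untl.2 (.inl h)
        | step hD h _ ih =>
          obtain ⟨a, rfl, -⟩ := h
          exact cons_mem_langFin_untl.2 (.inr ⟨(hφD _ _).2 hD, ih⟩)
      · intro h
        induction w with
        | nil => exact absurd h nil_notMem_langFin
        | cons a σ ih =>
          rcases cons_mem_langFin_untl.1 h with h | ⟨h, h'⟩
          · exact UntilOn.base h
          · exact UntilOn.step ((hφD _ _).1 h) ⟨a, rfl, rfl⟩ (ih h')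

end LTLClass

/-! ### The game on words with marked positions -/

section Game

variable {A : Type v} {C : Type u} {col : A → C} {k : ℕ}

/-- The letters strictly between the positions `i` and `j`. -/
def List.segment (w : List A) (i j : ℕ) : List A := (w.drop (i + 1)).take (j - (i + 1))

theorem List.drop_succ_eq_segment {w : List A} {i : ℕ} {y : Fin w.length} (hi : i < y) :
    w.drop (i + 1) = w.segment i y ++ w.get y :: w.drop (y + 1) := by
  have h : w.get y :: w.drop (y + 1) = (w.drop (i + 1)).drop (y - (i + 1)) := by
    rw [List.drop_drop, show i + 1 + (y - (i + 1)) = (y : ℕ) by omega, List.get_eq_getElem,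
      List.getElem_cons_drop]
  rw [h, List.segment, List.take_append_drop]

theorem List.segment_eq {w : List A} {i j : ℕ} {y : Fin w.length} (hi : i < y) (hj : y < j) :
    w.segment i j = w.segment i y ++ w.get y :: w.segment y j := by
  have hlen : (w.segment i y).length = y - (i + 1) := by
    have := y.2
    simp only [List.segment, List.length_take, List.length_drop]
    omega
  rw [List.segment, List.drop_succ_eq_segment hi, List.take_append, hlen,
    List.take_of_length_le (by omega), show j - (i + 1) - (y - (i + 1)) = j - (y + 1) + 1 by omega,
    List.take_succ_cons, List.segment, List.segment]

theorem List.length_segment {w : List A} {i j : ℕ} (hj : j ≤ w.length) :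
    (w.segment i j).length = j - (i + 1) := by
  simp only [List.segment, List.length_take, List.length_drop]
  omega

theorem List.exists_of_drop_succ_eq {w : List A} {i : ℕ} {u v : List A} {a : A}
    (h : w.drop (i + 1) = u ++ a :: v) :
    ∃ y : Fin w.length, i < y ∧ w.segment i y = u ∧ w.get y = a ∧ w.drop (y + 1) = v := by
  have hl := congrArg List.length h
  simp only [List.length_drop, List.length_append, List.length_cons] at hl
  let y : Fin w.length := ⟨i + 1 + u.length, by omega⟩
  have hy : i < y := by simp only [y]; omega
  rw [List.drop_succ_eq_segment hy] at h
  obtain ⟨h1, h2⟩ := List.append_inj h (by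
    rw [List.length_segment y.2.le]; simp only [y]; omega)
  obtain ⟨h2, h3⟩ := List.cons.inj h2
  exact ⟨y, hy, h1, h2, h3⟩

theorem List.exists_of_segment_eq {w : List A} {i j : ℕ} (hj : j < w.length) {u v : List A} {a : A}
    (h : w.segment i j = u ++ a :: v) :
    ∃ y : Fin w.length, i < y ∧ y < j ∧ w.segment i y = u ∧ w.get y = a ∧ w.segment y j = v := by
  have hl := congrArg List.length h
  simp only [List.length_segment hj.le, List.length_append, List.length_cons] at hl
  let y : Fin w.length := ⟨i + 1 + u.length, by omega⟩
  have hy : i < y := by simp only [y]; omega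
  have hyj : y < j := by simp only [y]; omega
  rw [List.segment_eq hy hyj] at h
  obtain ⟨h1, h2⟩ := List.append_inj h (by
    rw [List.length_segment y.2.le]; simp only [y]; omega)
  obtain ⟨h2, h3⟩ := List.cons.inj h2
  exact ⟨y, hy, hyj, h1, h2, h3⟩

/-- Similarity of two words with marked positions: the marks are ordered and coloured alike, the
segments between marks have the same rank-`k` type, and the suffixes after marks compare in one
direction. -/
structure MarkedSim {I : Type*} (col : A → C) (k : ℕ) {w w' : List A} (e : I → Fin w.length)
    (e' : I → Fin w'.length) : Prop where
  lt_iff : ∀ x y, e x < e y ↔ e' x < e' y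
  color : ∀ x, col (w.get (e x)) = col (w'.get (e' x))
  segment : ∀ x y, e x < e y →
    wordType col k (w.segment (e x) (e y)) = wordType col k (w'.segment (e' x) (e' y))
  tail : ∀ x, TailLE col k (w.drop (e x + 1)) (w'.drop (e' x + 1))

namespace MarkedSim

variable {I J : Type*} {w w' : List A} {e : I → Fin w.length} {e' : I → Fin w'.length}

theorem of_initial {a b : A} {u v : List A} {e : I → Fin (a :: u).length}
    {e' : I → Fin (b :: v).length} (he : ∀ x, e x = ⟨0, Nat.succ_pos _⟩)
    (he' : ∀ x, e' x = ⟨0, Nat.succ_pos _⟩) (hab : col a = col b) (huv : TailLE col k u v) :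
    MarkedSim col k e e' where
  lt_iff x y := by simp [he, he']
  color x := by rw [he, he']; exact hab
  segment x y hxy := absurd hxy (by simp [he])
  tail x := by rw [he, he']; exact huv

theorem of_succ (h : MarkedSim col (k + 1) e e') : MarkedSim col k e e' where
  lt_iff := h.lt_iff
  color := h.color
  segment x y hxy := wordType_eq_of_succ (h.segment x y hxy)
  tail x := (h.tail x).of_succ

theorem comp (h : MarkedSim col k e e') (f : J → I) : MarkedSim col k (e ∘ f) (e' ∘ f) where
  lt_iff _ _ := h.lt_iff _ _
  color _ := h.color _
  segment _ _ := h.segment _ _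
  tail _ := h.tail _

theorem le_iff (h : MarkedSim col k e e') (x y : I) : e x ≤ e y ↔ e' x ≤ e' y := by
  rw [← not_lt, ← not_lt, h.lt_iff]

theorem eq_iff (h : MarkedSim col k e e') (x y : I) : e x = e y ↔ e' x = e' y := by
  rw [le_antisymm_iff, le_antisymm_iff, h.le_iff, h.le_iff]

/-- A new pair of marks may be inserted right after the marks `e i`, `e' i`. -/
theorem insert (h : MarkedSim col (k + 1) e e') {y : Fin w.length} {y' : Fin w'.length} {i : I}
    (hi : e i < y) (hi' : e' i < y') (hcol : col (w.get y) = col (w'.get y'))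
    (hseg : wordType col k (w.segment (e i) y) = wordType col k (w'.segment (e' i) y'))
    (htail : TailLE col k (w.drop (y + 1)) (w'.drop (y' + 1)))
    (hz : ∀ z, e z ≤ e i ∨ y < e z ∧ y' < e' z ∧
      wordType col k (w.segment y (e z)) = wordType col k (w'.segment y' (e' z))) :
    MarkedSim col k (fun o : Option I => o.elim y e) (fun o : Option I => o.elim y' e') := by
  have hle : ∀ z, e z ≤ e i → e z < y ∧ e' z < y' := fun z hz =>
    ⟨hz.trans_lt hi, ((h.le_iff _ _).1 hz).trans_lt hi'⟩
  refine ⟨?_, ?_, ?_, ?_⟩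
  · rintro (_ | x) (_ | z)
    · simp
    · rcases hz z with hz | ⟨h1, h2, -⟩
      · simp [(hle z hz).1.not_gt, (hle z hz).2.not_gt]
      · simp [h1, h2]
    · rcases hz x with hx | ⟨h1, h2, -⟩
      · simp [(hle x hx).1, (hle x hx).2]
      · simp [h1.not_gt, h2.not_gt]
    · exact h.lt_iff x z
  · rintro (_ | x)
    · exact hcol
    · exact h.color x
  · rintro (_ | x) (_ | z) hxz
    · exact absurd hxz (lt_irrefl _)
    · rcases hz z with hz | ⟨-, -, h3⟩
      · exact absurd hxz (hle z hz).1.not_gt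
      · exact h3
    · rcases hz x with hx | ⟨h1, -, -⟩
      · change wordType col k (w.segment (e x) y) = wordType col k (w'.segment (e' x) y')
        rcases hx.eq_or_lt with hx | hx
        · rw [hx, (h.eq_iff _ _).1 hx]
          exact hseg
        · rw [List.segment_eq (y := e i) hx hi, List.segment_eq (y := e' i) ((h.lt_iff _ _).1 hx) hi']
          exact wordType_append (wordType_eq_of_succ (h.segment _ _ hx))
            (wordType_cons (h.color i) hseg)
      · exact absurd hxz h1.not_gt
    · exact wordType_eq_of_succ (h.segment x z hxz)
  · rintro (_ | x)
    · exact htail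
    · exact (h.tail x).of_succ

/-- A new pair of marks may be inserted between adjacent marks. -/
theorem insert_between (h : MarkedSim col (k + 1) e e') {y : Fin w.length} {y' : Fin w'.length}
    {i j : I} (hi : e i < y) (hi' : e' i < y') (hj : y < e j) (hj' : y' < e' j)
    (hcol : col (w.get y) = col (w'.get y'))
    (hseg : wordType col k (w.segment (e i) y) = wordType col k (w'.segment (e' i) y'))
    (hseg' : wordType col k (w.segment y (e j)) = wordType col k (w'.segment y' (e' j)))
    (hz : ∀ z, e z ≤ e i ∨ e j ≤ e z) :
    MarkedSim col k (fun o : Option I => o.elim y e) (fun o : Option I => o.elim y' e') := by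
  refine h.insert hi hi' hcol hseg ?_ fun z => (hz z).imp_right fun hz => ?_
  · rw [List.drop_succ_eq_segment (y := e j) hj, List.drop_succ_eq_segment (y := e' j) hj']
    exact TailLE.append hseg' (TailLE.cons (h.color j) (h.tail j).of_succ)
  · refine ⟨hj.trans_le hz, hj'.trans_le ((h.le_iff _ _).1 hz), ?_⟩
    rcases hz.eq_or_lt with hz | hz
    · rw [← hz, ← (h.eq_iff _ _).1 hz]
      exact hseg'
    · rw [List.segment_eq (y := e j) hj hz, List.segment_eq (y := e' j) hj' ((h.lt_iff _ _).1 hz)]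
      exact wordType_append hseg'
        (wordType_cons (h.color j) (wordType_eq_of_succ (h.segment _ _ hz)))

/-- A position that is already marked may be marked once more. -/
theorem repeat_mark (h : MarkedSim col (k + 1) e e') (x : I) :
    MarkedSim col k (fun o : Option I => o.elim (e x) e) (fun o : Option I => o.elim (e' x) e') := by
  convert h.of_succ.comp (fun o : Option I => o.elim x id) using 1 <;>
  · ext o
    cases o <;> rfl

end MarkedSim

theorem exists_greatest_mark_lt {I : Type*} [Finite I] {n : ℕ} (e : I → Fin n) {y : Fin n}
    (h : ∃ x, e x < y) : ∃ i, e i < y ∧ ∀ z, e z < y → e z ≤ e i := by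
  obtain ⟨x, hx⟩ := h
  have : Nonempty {x // e x < y} := ⟨⟨x, hx⟩⟩
  obtain ⟨i, hi⟩ := Finite.exists_max fun x : {x // e x < y} => e x.1
  exact ⟨i.1, i.2, fun z hz => hi ⟨z, hz⟩⟩

theorem exists_least_mark_gt {I : Type*} [Finite I] {n : ℕ} (e : I → Fin n) {y : Fin n}
    (h : ∃ x, y < e x) : ∃ j, y < e j ∧ ∀ z, y < e z → e j ≤ e z := by
  obtain ⟨x, hx⟩ := h
  have : Nonempty {x // y < e x} := ⟨⟨x, hx⟩⟩
  obtain ⟨j, hj⟩ := Finite.exists_min fun x : {x // y < e x} => e x.1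
  exact ⟨j.1, j.2, fun z hz => hj ⟨z, hz⟩⟩

namespace MarkedSim

variable {I : Type*} [Finite I] {w w' : List A} {e : I → Fin w.length} {e' : I → Fin w'.length}

/-- A position of the first word to the right of some mark can be matched in the second. -/
theorem forth (h : MarkedSim col (k + 1) e e') {y : Fin w.length} (hy : ∃ x, e x < y) :
    ∃ y', MarkedSim col k (fun o : Option I => o.elim y e) (fun o : Option I => o.elim y' e') := by
  by_cases hmark : ∃ x, e x = y
  · obtain ⟨x, rfl⟩ := hmark
    exact ⟨e' x, h.repeat_mark x⟩
  push Not at hmark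
  obtain ⟨i, hi, himax⟩ := exists_greatest_mark_lt e hy
  by_cases hright : ∃ x, y < e x
  · obtain ⟨j, hj, hjmin⟩ := exists_least_mark_gt e hright
    obtain ⟨u', a', v', hw', h1, h2, h3⟩ := exists_split_of_wordType_eq
      (h.segment i j (hi.trans hj)) (List.segment_eq hi hj)
    obtain ⟨y', hi', hj', rfl, rfl, rfl⟩ := List.exists_of_segment_eq (e' j).2 hw'
    exact ⟨y', h.insert_between hi hi' hj hj' h2 h1 h3 fun z =>
      (hmark z).lt_or_gt.imp (himax z) (hjmin z)⟩
  · obtain ⟨u', a', v', hw', h1, h2, h3⟩ := h.tail i _ _ _ (List.drop_succ_eq_segment hi)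
    obtain ⟨y', hi', rfl, rfl, rfl⟩ := List.exists_of_drop_succ_eq hw'
    push Not at hright
    exact ⟨y', h.insert hi hi' h2 h1 h3 fun z => .inl (himax z ((hmark z).lt_of_le (hright z)))⟩

/-- A position of the second word between two marks can be matched in the first. -/
theorem back (h : MarkedSim col (k + 1) e e') {y' : Fin w'.length} (hy : ∃ x, e' x < y')
    (hy' : ∃ x, y' < e' x) :
    ∃ y, MarkedSim col k (fun o : Option I => o.elim y e) (fun o : Option I => o.elim y' e') := by
  by_cases hmark : ∃ x, e' x = y'
  · obtain ⟨x, rfl⟩ := hmark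
    exact ⟨e x, h.repeat_mark x⟩
  push Not at hmark
  obtain ⟨i, hi', himax⟩ := exists_greatest_mark_lt e' hy
  obtain ⟨j, hj', hjmin⟩ := exists_least_mark_gt e' hy'
  obtain ⟨u, a, v, hw, h1, h2, h3⟩ := exists_split_of_wordType_eq
    (h.segment i j ((h.lt_iff _ _).2 (hi'.trans hj'))).symm (List.segment_eq hi' hj')
  obtain ⟨y, hi, hj, rfl, rfl, rfl⟩ := List.exists_of_segment_eq (e j).2 hw
  refine ⟨y, h.insert_between hi hi' hj hj' h2.symm h1.symm h3.symm fun z => ?_⟩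
  rw [h.le_iff, h.le_iff]
  exact (hmark z).lt_or_gt.imp (himax z) (hjmin z)

end MarkedSim

end Game

/-! ### coSafetyFO is preserved by the game -/

namespace FOTLO

variable {AP : Type u} {α : Type v} {n : ℕ} {σ : List (Set AP)} {v : α → WordDomain σ}
  {xs : Fin n → WordDomain σ}

theorem realize_ltF (x y : α ⊕ Fin n) :
    (ltF (AP := AP) x y).Realize v xs ↔ Sum.elim v xs x < Sum.elim v xs y := by
  rw [ltF, FirstOrder.Language.BoundedFormula.realize_rel₂]
  rfl

theorem realize_eqF (x y : α ⊕ Fin n) :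
    (eqF (AP := AP) x y).Realize v xs ↔ Sum.elim v xs x = Sum.elim v xs y :=
  FirstOrder.Language.BoundedFormula.realize_bdEqual _ _

theorem realize_predF (p : AP) (x : α ⊕ Fin n) :
    (predF p x).Realize v xs ↔ p ∈ σ.get (Sum.elim v xs x) := by
  rw [predF, FirstOrder.Language.BoundedFormula.realize_rel₁]
  rfl

theorem elim_snoc_up (y : WordDomain σ) (x : α ⊕ Fin n) :
    Sum.elim v (Fin.snoc xs y : Fin (n + 1) → WordDomain σ) (up x) = Sum.elim v xs x := by
  rcases x with x | x <;> simp [up]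

theorem elim_snoc_bvar (y : WordDomain σ) :
    Sum.elim v (Fin.snoc xs y : Fin (n + 1) → WordDomain σ) bvar = y := by
  simp [bvar]

theorem realize_guarded_ex (x : α ⊕ Fin n) (φ : (FOTLO AP).BoundedFormula α (n + 1)) :
    (ltF (up x) bvar ⊓ φ).ex.Realize v xs ↔
      ∃ y, Sum.elim v xs x < y ∧ φ.Realize v (Fin.snoc xs y) := by
  simp only [FirstOrder.Language.BoundedFormula.realize_ex,
    FirstOrder.Language.BoundedFormula.realize_inf, realize_ltF, elim_snoc_up, elim_snoc_bvar]

theorem realize_guarded_all (x z : α ⊕ Fin n) (φ : (FOTLO AP).BoundedFormula α (n + 1)) :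
    ((ltF (up x) bvar ⊓ ltF bvar (up z)).imp φ).all.Realize v xs ↔
      ∀ y, Sum.elim v xs x < y → y < Sum.elim v xs z → φ.Realize v (Fin.snoc xs y) := by
  simp only [FirstOrder.Language.BoundedFormula.realize_all,
    FirstOrder.Language.BoundedFormula.realize_imp,
    FirstOrder.Language.BoundedFormula.realize_inf, realize_ltF, elim_snoc_up, elim_snoc_bvar,
    and_imp]

/-- Marking a further position, on the level of assignments. -/
theorem markedSim_snoc {C : Type*} {col : Set AP → C} {k : ℕ} {σ' : List (Set AP)}
    {v' : α → WordDomain σ'} {xs' : Fin n → WordDomain σ'} {y : WordDomain σ} {y' : WordDomain σ'}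
    (h : MarkedSim col k (fun o : Option (α ⊕ Fin n) => o.elim y (Sum.elim v xs))
      (fun o : Option (α ⊕ Fin n) => o.elim y' (Sum.elim v' xs'))) :
    MarkedSim col k (Sum.elim v (Fin.snoc xs y : Fin (n + 1) → WordDomain σ))
      (Sum.elim v' (Fin.snoc xs' y' : Fin (n + 1) → WordDomain σ')) := by
  convert h.comp (Sum.elim (fun a => some (.inl a))
    (Fin.snoc (fun i => some (.inr i)) none : Fin (n + 1) → Option (α ⊕ Fin n))) using 1 <;>
  · ext x
    rcases x with x | x
    · rfl
    · induction x using Fin.lastCases <;> simp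

/-- The truth of a coSafetyFO formula is preserved by marked similarity, for any rank that is at
least its quantifier depth and any set of letters that contains its letters. Only existential
quantifiers reach beyond the last mark, which is why a one-sided comparison of tails suffices. -/
theorem IsCoSafety.exists_rank [Finite α] {φ : (FOTLO AP).BoundedFormula α n}
    (hφ : IsCoSafety φ) :
    ∃ (d : ℕ) (P : Finset AP), ∀ k ≥ d, ∀ Q ⊇ P, ∀ (σ σ' : List (Set AP)) (v : α → WordDomain σ)
      (xs : Fin n → WordDomain σ) (v' : α → WordDomain σ') (xs' : Fin n → WordDomain σ'),
      MarkedSim (letterColor Q) k (Sum.elim v xs) (Sum.elim v' xs') →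
      φ.Realize v xs → φ.Realize v' xs' := by
  classical
  have hcol : ∀ {Q : Finset AP} {p : AP} {a b : Set AP}, {p} ⊆ Q →
      letterColor Q a = letterColor Q b → (p ∈ a ↔ p ∈ b) := by
    intro Q p a b hp h
    exact iff_of_eq (congrFun h ⟨p, hp (Finset.mem_singleton_self p)⟩)
  induction hφ with
  | lt x y =>
    refine ⟨0, ∅, fun k _ Q _ σ σ' v xs v' xs' h => ?_⟩
    rw [realize_ltF, realize_ltF]
    exact (h.lt_iff x y).1
  | eq x y =>
    refine ⟨0, ∅, fun k _ Q _ σ σ' v xs v' xs' h => ?_⟩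
    rw [realize_eqF, realize_eqF]
    exact (h.eq_iff x y).1
  | ne x y =>
    refine ⟨0, ∅, fun k _ Q _ σ σ' v xs v' xs' h => ?_⟩
    rw [FirstOrder.Language.BoundedFormula.realize_not,
      FirstOrder.Language.BoundedFormula.realize_not, realize_eqF, realize_eqF, h.eq_iff]
    exact id
  | pred p x =>
    refine ⟨0, {p}, fun k _ Q hQ σ σ' v xs v' xs' h => ?_⟩
    rw [realize_predF, realize_predF]
    exact (hcol hQ (h.color x)).1
  | notPred p x =>
    refine ⟨0, {p}, fun k _ Q hQ σ σ' v xs v' xs' h => ?_⟩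
    rw [FirstOrder.Language.BoundedFormula.realize_not,
      FirstOrder.Language.BoundedFormula.realize_not, realize_predF, realize_predF,
      hcol hQ (h.color x)]
    exact id
  | or _ _ ih₁ ih₂ =>
    obtain ⟨d₁, P₁, h₁⟩ := ih₁
    obtain ⟨d₂, P₂, h₂⟩ := ih₂
    refine ⟨max d₁ d₂, P₁ ∪ P₂, fun k hk Q hQ σ σ' v xs v' xs' h => ?_⟩
    rw [FirstOrder.Language.BoundedFormula.realize_sup,
      FirstOrder.Language.BoundedFormula.realize_sup]
    exact Or.imp (h₁ k (le_of_max_le_left hk) Q (Finset.union_subset_left hQ) _ _ _ _ _ _ h)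
      (h₂ k (le_of_max_le_right hk) Q (Finset.union_subset_right hQ) _ _ _ _ _ _ h)
  | and _ _ ih₁ ih₂ =>
    obtain ⟨d₁, P₁, h₁⟩ := ih₁
    obtain ⟨d₂, P₂, h₂⟩ := ih₂
    refine ⟨max d₁ d₂, P₁ ∪ P₂, fun k hk Q hQ σ σ' v xs v' xs' h => ?_⟩
    rw [FirstOrder.Language.BoundedFormula.realize_inf,
      FirstOrder.Language.BoundedFormula.realize_inf]
    exact And.imp (h₁ k (le_of_max_le_left hk) Q (Finset.union_subset_left hQ) _ _ _ _ _ _ h)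
      (h₂ k (le_of_max_le_right hk) Q (Finset.union_subset_right hQ) _ _ _ _ _ _ h)
  | ex x _ ih =>
    obtain ⟨d, P, h₁⟩ := ih
    refine ⟨d + 1, P, fun k hk Q hQ σ σ' v xs v' xs' h => ?_⟩
    obtain ⟨k, rfl⟩ : ∃ k', k = k' + 1 := ⟨k - 1, by omega⟩
    rw [realize_guarded_ex, realize_guarded_ex]
    rintro ⟨y, hy, hr⟩
    obtain ⟨y', h'⟩ := h.forth ⟨x, hy⟩
    exact ⟨y', (h'.lt_iff (some x) none).1 hy,
      h₁ k (by omega) Q hQ _ _ _ _ _ _ (markedSim_snoc h') hr⟩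
  | all x z _ ih =>
    obtain ⟨d, P, h₁⟩ := ih
    refine ⟨d + 1, P, fun k hk Q hQ σ σ' v xs v' xs' h => ?_⟩
    obtain ⟨k, rfl⟩ : ∃ k', k = k' + 1 := ⟨k - 1, by omega⟩
    rw [realize_guarded_all, realize_guarded_all]
    intro hr y' hxy hyz
    obtain ⟨y, h'⟩ := h.back ⟨x, hxy⟩ ⟨z, hyz⟩
    exact h₁ k (by omega) Q hQ _ _ _ _ _ _ (markedSim_snoc h')
      (hr y ((h'.lt_iff (some x) none).2 hxy) ((h'.lt_iff none (some z)).2 hyz))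

/-- A language definable in coSafetyFO is a finite union of languages "a letter of colour `c`,
then a word of an up-set", hence definable in coSafetyLTL without weak tomorrow. -/
theorem langFin_mem_ltlClass [Nonempty AP] {φ : (FOTLO AP).Formula (Fin 1)} (hφ : IsCoSafety φ) :
    langFin φ ∈ ltlClass AP := by
  obtain ⟨k, P, hk⟩ := hφ.exists_rank
  have h𝒟 := temporalClass_ltlClass (AP := AP) P
  obtain ⟨hfin, hmem⟩ := upSet_finite_and_mem h𝒟 k
  let 𝒮 : Set (Set (List (Set AP))) := {S | ∃ a σ, a :: σ ∈ langFin φ ∧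
    S = nextSet (colorStep (letterColor P)) (letterColor P a)
      {σ' | TailLE (letterColor P) k σ σ'}}
  have h𝒮 : 𝒮.Finite := by
    refine (Set.finite_univ.image2 (nextSet (colorStep (letterColor P))) hfin).subset ?_
    rintro _ ⟨a, σ, -, rfl⟩
    exact ⟨_, trivial, _, ⟨σ, rfl⟩, rfl⟩
  convert h𝒟.sUnion_mem h𝒮 ?_ using 1
  · ext w
    constructor
    · intro hw
      cases w with
      | nil => exact absurd hw.1 (by simp)
      | cons a σ => exact ⟨_, ⟨a, σ, hw, rfl⟩, σ, ⟨a, rfl, rfl⟩, TailLE.refl⟩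
    · rintro ⟨_, ⟨a, σ, ⟨h0, hr⟩, rfl⟩, σ', ⟨b, rfl, hab⟩, hle⟩
      refine ⟨Nat.succ_pos _, ?_⟩
      rw [FirstOrder.Language.Formula.Realize] at hr ⊢
      refine hk k le_rfl P subset_rfl (a :: σ) (b :: σ') _ _ _ _ (.of_initial ?_ ?_ hab hle) hr
      all_goals
        rintro (x | x)
        · rfl
        · exact x.elim0
  · rintro _ ⟨a, σ, -, rfl⟩
    exact h𝒟.next_mem _ (hmem σ)

end FOTLO

/-! ### From temporal to first-order formulas -/

/-- The standard translation, at an arbitrary variable. -/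
theorem LTL.exists_coSafetyFO {AP : Type u} {φ : LTL AP} (hφ : φ.IsCoSafety)
    (hφ' : φ.WeakNextFree) {α : Type v} {n : ℕ} (x : α ⊕ Fin n) :
    ∃ χ : (FOTLO AP).BoundedFormula α n, FOTLO.IsCoSafety χ ∧
      ∀ (σ : List (Set AP)) (v : α → WordDomain σ) (xs : Fin n → WordDomain σ),
        χ.Realize v xs ↔ Sat σ φ (Sum.elim v xs x) := by
  induction hφ generalizing n with
  | atom p => exact ⟨_, .pred p x, fun σ v xs => FOTLO.realize_predF p x⟩
  | notAtom p =>
    exact ⟨_, .notPred p x, fun σ v xs => by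
      rw [FirstOrder.Language.BoundedFormula.realize_not, FOTLO.realize_predF]; rfl⟩
  | or _ _ ih₁ ih₂ =>
    obtain ⟨χ₁, h₁, hr₁⟩ := ih₁ hφ'.1 x
    obtain ⟨χ₂, h₂, hr₂⟩ := ih₂ hφ'.2 x
    exact ⟨_, .or h₁ h₂, fun σ v xs => by
      rw [FirstOrder.Language.BoundedFormula.realize_sup, hr₁, hr₂]; rfl⟩
  | and _ _ ih₁ ih₂ =>
    obtain ⟨χ₁, h₁, hr₁⟩ := ih₁ hφ'.1 x
    obtain ⟨χ₂, h₂, hr₂⟩ := ih₂ hφ'.2 x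
    exact ⟨_, .and h₁ h₂, fun σ v xs => by
      rw [FirstOrder.Language.BoundedFormula.realize_inf, hr₁, hr₂]; rfl⟩
  | next _ ih =>
    -- the successor of `x` is the `y > x` with nothing between; falsity is `x < x`
    obtain ⟨χ, h, hr⟩ := ih hφ' (n := n + 1) FOTLO.bvar
    refine ⟨_, .ex x (.and h (.all (FOTLO.up x) FOTLO.bvar
      (.lt FOTLO.bvar FOTLO.bvar))), fun σ v xs => ?_⟩
    simp only [FOTLO.realize_guarded_ex, FirstOrder.Language.BoundedFormula.realize_inf, hr,
      FOTLO.realize_guarded_all, FOTLO.realize_ltF, FOTLO.elim_snoc_up, FOTLO.elim_snoc_bvar,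
      lt_irrefl]
    constructor
    · rintro ⟨y, hxy, hs, hgap⟩
      have hy : ((Sum.elim v xs x : WordDomain σ) : ℕ) + 1 = y := by
        refine le_antisymm hxy (not_lt.1 fun hlt => ?_)
        exact hgap ⟨((Sum.elim v xs x : WordDomain σ) : ℕ) + 1, hlt.trans y.2⟩
          (Nat.lt_succ_self _) hlt
      refine ⟨hy ▸ y.2, ?_⟩
      convert hs
    · rintro ⟨hlt, hs⟩
      exact ⟨_, Nat.lt_succ_self _, hs, fun z hz hz' => absurd hz (Nat.lt_succ_iff.1 hz').not_gt⟩
  | weakNext _ _ => exact hφ'.elim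
  | untl _ _ ih₁ ih₂ =>
    -- the guard `x < y` is strict, while until may be fulfilled at `x` itself
    obtain ⟨χ₁, h₁, hr₁⟩ := ih₁ hφ'.1 x
    obtain ⟨χ₁', h₁', hr₁'⟩ := ih₁ hφ'.1 (n := n + 2) FOTLO.bvar
    obtain ⟨χ₂, h₂, hr₂⟩ := ih₂ hφ'.2 x
    obtain ⟨χ₂', h₂', hr₂'⟩ := ih₂ hφ'.2 (n := n + 1) FOTLO.bvar
    refine ⟨_, .or h₂ (.and h₁ (.ex x (.and h₂' (.all (FOTLO.up x) FOTLO.bvar h₁')))),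
      fun σ v xs => ?_⟩
    simp only [FOTLO.realize_guarded_ex, FirstOrder.Language.BoundedFormula.realize_inf, hr₁, hr₂,
      hr₁', hr₂', FirstOrder.Language.BoundedFormula.realize_sup,
      FOTLO.realize_guarded_all, FOTLO.elim_snoc_up, FOTLO.elim_snoc_bvar]
    constructor
    · rintro (h | ⟨h, y, hxy, hy, hz⟩)
      · exact ⟨_, le_rfl, h, fun k hk hk' => absurd hk hk'.not_ge⟩
      · refine ⟨y, hxy.le, hy, fun k hk hk' => ?_⟩
        rcases hk.eq_or_lt with rfl | hk
        · exact h
        · exact hz k hk hk'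
    · rintro ⟨y, hxy, hy, hz⟩
      rcases hxy.eq_or_lt with rfl | hxy
      · exact .inl hy
      · exact .inr ⟨hz _ le_rfl hxy, y, hxy, hy, fun k hk hk' => hz k hk.le hk'⟩

theorem mainTheorem5 (AP : Type*) [Nonempty AP] :
    semFinCoSafetyFO AP = semFinCoSafetyLTLNoWeak AP := by
  ext L
  constructor
  · rintro ⟨φ, hφ, rfl⟩
    rcases FOTLO.langFin_mem_ltlClass hφ with h | h
    -- the empty word is in no language of a formula
    · have hnil : ([] : List (Set AP)) ∈ FOTLO.langFin φ := h ▸ Set.mem_univ _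
      exact absurd hnil.1 (by simp)
    · exact h
  · rintro ⟨φ, hφ, rfl⟩
    obtain ⟨χ, hχ, hr⟩ := φ.exists_coSafetyFO hφ.1 hφ.2 (n := 0) (.inl (0 : Fin 1))
    refine ⟨χ, hχ, ?_⟩
    ext σ
    exact exists_congr fun h => (hr σ (fun _ => ⟨0, h⟩) default).symm
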